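/- **Setting.** Let $G:\mathbb R\to\mathbb R$ be twice continuously differentiable, neither linear nor quadratic, with $E[G(N)]=0$ for $N$ standard Gaussian, and let $g=G'$. Let $x_i=\mu+z_i$ $(i\ge 1)$, where $\mu\in\mathbb R^p$ and $z_1,z_2,\dots$ are i.i.d. random vectors in $\mathbb R^p$ with independent components, at most one of them Gaussian, each with mean $0$ and variance $1$. (This is the independent component model with mixing matrix $I_p$.) Write $z_{(k)}$ for the $k$th component of $z_1$ and assume that $E[z_{(k)}^4]$ and $$\nu_k=E[G(z_{(k)})],\quad E[g(z_{(k)})],\quad \sigma_k^2=\mathrm{Var}[g(z_{(k)})],\quad \lambda_k=E[g(z_{(k)})z_{(k)}],\quad \delta_k=E[g'(z_{(k)})],\quad E[g'(z_{(k)})z_{(k)}]$$ exist for all $k$. Let $s_k=\mathrm{sign}(\nu_k)$. Assume the following regularity: for each $k$ there is $r>0$ such that $\sup\{|g'(u^Tz_1+t)|\,(1+\|z_1\|^2):\|u-e_k\|\le r,\ |t|\le r\}$ is bounded by an integrable random variable. Assume further that $\nu_k(\lambda_k-\delta_k)\ge 0$ for all $k$, with equality for at most one $k$. **Estimates.** Let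 $\bar x$ and $\hat S$ be the mean and the covariance matrix of the empirical distribution of $x_1,\dots,x_n$, and put $\hat G(\gamma)=\frac1n\sum_{i=1}^n G(\gamma^T(x_i-\bar x))$ and $\hat T(\gamma)=\frac1n\sum_{i=1}^n g(\gamma^T(x_i-\bar x))(x_i-\bar x)$. For a $p\times p$ matrix $\hat\Gamma=(\hat\gamma_1,\dots,\hat\gamma_p)^T$ with $\hat\Gamma\hat S\hat\Gamma^T=I_p$ consider the estimating equations - deflation-based: $\hat T(\hat\gamma_j)=\hat S\big(\sum_{l\le j}\hat\gamma_l\hat\gamma_l^T\big)\hat T(\hat\gamma_j)$ for all $j$; - symmetric: $\hat\gamma_l^T\hat T(\hat\gamma_j)\,\mathrm{sign}(\hat G(\hat\gamma_j))=\hat\gamma_j^T\hat T(\hat\gamma_l)\,\mathrm{sign}(\hat G(\hat\gamma_l))$ for all $j,l$; - squared symmetric: $\hat G(\hat\gamma_j)\,\hat\gamma_l^T\hat T(\hat\gamma_j)=\hat G(\hat\gamma_l)\,\hat\gamma_j^T\hat T(\hat\gamma_l)$ for all $j,l$. In each case the estimate is any sequence $\hat\Gamma=\hat\Gamma_n$ of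 random matrices that satisfies the constraint and the equations with probability tending to one and converges in probability to $I_p$. For $j\neq l$, $ASV(\hat\gamma_{jl})$ denotes the variance of the centred normal limit in distribution of $\sqrt n\,\hat\gamma_{jl}$. **Theorem.** Let $j\ne l$ and let $z_{(j)},z_{(l)}$ be non-Gaussian with $\nu_j(\lambda_j-\delta_j)\neq0$ and $\nu_l(\lambda_l-\delta_l)\ne 0$. Put $\alpha_k=(\sigma_k^2-\lambda_k^2)/(\lambda_k-\delta_k)^2$ for $k\in\{j,l\}$. Then for each of the three estimates $\sqrt n\,\hat\gamma_{jl}$ and $\sqrt n\,\hat\gamma_{lj}$ converge in distribution to centred normal laws, and $$ASV(\hat\gamma_{jl})+ASV(\hat\gamma_{lj})=\Big(\frac{\beta_j}{\beta_j+\beta_l}\Big)^2(2\alpha_j+1)+\Big(\frac{\beta_l}{\beta_j+\beta_l}\Big)^2(2\alpha_l+1),$$ where - deflation-based, with $j<l$ (component $j$ is extracted before component $l$) and $\lambda_k\ne\delta_k$ for all $k<j$: $\beta_j=1$, $\beta_l=0$; - symmetric, provided that $\lambda_k=\delta_k$ for any $k$ with $\nu_k=0$: $\beta_j=s_j(\lambda_j-\delta_j)$,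 $\beta_l=s_l(\lambda_l-\delta_l)$; - squared symmetric: $\beta_j=\nu_j(\lambda_j-\delta_j)$, $\beta_l=\nu_l(\lambda_l-\delta_l)$. -/

import Mathlib

open MeasureTheory ProbabilityTheory Filter Topology
open scoped Matrix NNReal

namespace FastICA

/-! ### The nonlinearity -/

/-- The function `G` of the FastICA objective: twice continuously differentiable, neither linear nor
quadratic, and with mean zero under the standard Gaussian law.  The nonlinearity is `g = deriv G`. -/
structure IsContrast (G : ℝ → ℝ) : Prop where
  contDiff : ContDiff ℝ 2 G
  nonquadratic : ¬ ∃ a b c : ℝ, ∀ y, G y = a * y ^ 2 + b * y + c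
  gaussian_integrable : Integrable G (gaussianReal 0 1)
  gaussian_mean : ∫ y, G y ∂(gaussianReal 0 1) = 0

/-! ### Population quantities of one component `Y` -/

section Population

variable {Ω : Type*} [MeasurableSpace Ω]

/-- `ν = E[G(Y)]`. -/
noncomputable def nu (P : Measure Ω) (G : ℝ → ℝ) (Y : Ω → ℝ) : ℝ := ∫ ω, G (Y ω) ∂P

/-- `σ² = Var[g(Y)]`. -/
noncomputable def sigmaSq (P : Measure Ω) (G : ℝ → ℝ) (Y : Ω → ℝ) : ℝ :=
  variance (fun ω => deriv G (Y ω)) P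

/-- `λ = E[g(Y) Y]`. -/
noncomputable def lam (P : Measure Ω) (G : ℝ → ℝ) (Y : Ω → ℝ) : ℝ := ∫ ω, deriv G (Y ω) * Y ω ∂P

/-- `δ = E[g'(Y)]`. -/
noncomputable def del (P : Measure Ω) (G : ℝ → ℝ) (Y : Ω → ℝ) : ℝ :=
  ∫ ω, deriv (deriv G) (Y ω) ∂P

/-- `α = (σ² - λ²) / (λ - δ)²`. -/
noncomputable def alpha (P : Measure Ω) (G : ℝ → ℝ) (Y : Ω → ℝ) : ℝ :=
  (sigmaSq P G Y - lam P G Y ^ 2) / (lam P G Y - del P G Y) ^ 2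

/-- `s = sign ν`. -/
noncomputable def sgn (P : Measure Ω) (G : ℝ → ℝ) (Y : Ω → ℝ) : ℝ := Real.sign (nu P G Y)

/-- `Y` has a Gaussian law. -/
def IsGaussianVar (P : Measure Ω) (Y : Ω → ℝ) : Prop :=
  ∃ (m : ℝ) (v : ℝ≥0), P.map Y = gaussianReal m v

/-! ### The independent component model -/

/-- The latent vectors `z 0, z 1, …` form a random sample. -/
structure IsIIDSample {p : ℕ} (P : Measure Ω) (z : ℕ → Ω → Fin p → ℝ) : Prop where
  measurable : ∀ i, Measurable (z i)
  indep : iIndepFun z P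
  identDistrib : ∀ i, IdentDistrib (z i) (z 0) P P

/-- The latent vector has independent components, at most one of them Gaussian, each with mean zero
and variance one. -/
structure IsSource {p : ℕ} (P : Measure Ω) (Z : Ω → Fin p → ℝ) : Prop where
  indep : iIndepFun (fun (k : Fin p) (ω : Ω) => Z ω k) P
  atMostOneGaussian : ∀ k k' : Fin p,
    IsGaussianVar P (fun ω => Z ω k) → IsGaussianVar P (fun ω => Z ω k') → k = k'
  mean_zero : ∀ k, ∫ ω, Z ω k ∂P = 0
  second_moment : ∀ k, ∫ ω, Z ω k ^ 2 ∂P = 1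

/-- Existence of the moments of the components: `E[Y⁴]`, `E[G(Y)]`, `E[g(Y)]`, `Var[g(Y)]`,
`E[g(Y) Y]`, `E[g'(Y)]` and `E[g'(Y) Y]`. -/
structure HasMoments {p : ℕ} (P : Measure Ω) (G : ℝ → ℝ) (Z : Ω → Fin p → ℝ) : Prop where
  fourth : ∀ k, Integrable (fun ω => Z ω k ^ 4) P
  contrast : ∀ k, Integrable (fun ω => G (Z ω k)) P
  nonlin : ∀ k, MemLp (fun ω => deriv G (Z ω k)) 2 P
  nonlin_mul : ∀ k, Integrable (fun ω => deriv G (Z ω k) * Z ω k) P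
  deriv_nonlin : ∀ k, Integrable (fun ω => deriv (deriv G) (Z ω k)) P
  deriv_nonlin_mul : ∀ k, Integrable (fun ω => deriv (deriv G) (Z ω k) * Z ω k) P

/-- Regularity behind the first order Taylor expansion of the estimating equations: for every `k`
and some `r > 0`, the supremum of `|g'(uᵀZ + t)| (1 + ‖Z‖²)` over `‖u - e_k‖ ≤ r`, `|t| ≤ r` is
bounded by an integrable variable. -/
def LocallyDominated {p : ℕ} (P : Measure Ω) (G : ℝ → ℝ) (Z : Ω → Fin p → ℝ) : Prop :=
  ∀ k : Fin p, ∃ r > 0, ∃ M : Ω → ℝ, Integrable M P ∧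
    ∀ᵐ ω ∂P, ∀ (u : Fin p → ℝ) (t : ℝ), ‖u - Pi.single k 1‖ ≤ r → |t| ≤ r →
      |deriv (deriv G) (u ⬝ᵥ Z ω + t)| * (1 + ‖Z ω‖ ^ 2) ≤ M ω

end Population

/-! ### The three estimates, computed from the first `n` terms of a data sequence `x` -/

section Sample

variable {p : ℕ}

/-- The sample mean. -/
noncomputable def sampleMean (n : ℕ) (x : ℕ → Fin p → ℝ) : Fin p → ℝ :=
  (n : ℝ)⁻¹ • ∑ i ∈ Finset.range n, x i

/-- The sample covariance matrix (the covariance matrix of the empirical distribution). -/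
noncomputable def sampleCov (n : ℕ) (x : ℕ → Fin p → ℝ) : Matrix (Fin p) (Fin p) ℝ :=
  (n : ℝ)⁻¹ • ∑ i ∈ Finset.range n,
    Matrix.vecMulVec (x i - sampleMean n x) (x i - sampleMean n x)

/-- Sample version of `E[G(γᵀ(x - E x))]`. -/
noncomputable def sampleG (G : ℝ → ℝ) (n : ℕ) (x : ℕ → Fin p → ℝ) (γ : Fin p → ℝ) : ℝ :=
  (n : ℝ)⁻¹ * ∑ i ∈ Finset.range n, G (γ ⬝ᵥ (x i - sampleMean n x))

/-- Sample version of `T(γ) = E[g(γᵀ(x - E x)) (x - E x)]`. -/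
noncomputable def sampleT (G : ℝ → ℝ) (n : ℕ) (x : ℕ → Fin p → ℝ) (γ : Fin p → ℝ) : Fin p → ℝ :=
  (n : ℝ)⁻¹ • ∑ i ∈ Finset.range n,
    deriv G (γ ⬝ᵥ (x i - sampleMean n x)) • (x i - sampleMean n x)

/-- Sample version of `T₂(γ) = E[G(γᵀ(x - E x))] E[g(γᵀ(x - E x)) (x - E x)]`. -/
noncomputable def sampleT2 (G : ℝ → ℝ) (n : ℕ) (x : ℕ → Fin p → ℝ) (γ : Fin p → ℝ) : Fin p → ℝ :=
  sampleG G n x γ • sampleT G n x γ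

/-- The constraint `Γ Ŝ Γᵀ = I`, that is, `γ_lᵀ Ŝ γ_j = δ_lj` for the rows `γ_j` of `Γ`. -/
def IsWhitening (n : ℕ) (x : ℕ → Fin p → ℝ) (Γ : Matrix (Fin p) (Fin p) ℝ) : Prop :=
  Γ * sampleCov n x * Γᵀ = 1

/-- `Γ` solves the deflation-based estimating equations; the rows are extracted in the order
`0, 1, …, p - 1`, under the orthonormality constraint. -/
def IsDeflation (G : ℝ → ℝ) (n : ℕ) (x : ℕ → Fin p → ℝ) (Γ : Matrix (Fin p) (Fin p) ℝ) : Prop :=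
  IsWhitening n x Γ ∧
    ∀ j, sampleT G n x (Γ j) =
      (sampleCov n x * ∑ l ∈ Finset.Iic j, Matrix.vecMulVec (Γ l) (Γ l)) *ᵥ sampleT G n x (Γ j)

/-- `Γ` solves the symmetric estimating equations. -/
def IsSymmetric (G : ℝ → ℝ) (n : ℕ) (x : ℕ → Fin p → ℝ) (Γ : Matrix (Fin p) (Fin p) ℝ) : Prop :=
  IsWhitening n x Γ ∧
    ∀ j l, (Γ l ⬝ᵥ sampleT G n x (Γ j)) * Real.sign (sampleG G n x (Γ j)) =
      (Γ j ⬝ᵥ sampleT G n x (Γ l)) * Real.sign (sampleG G n x (Γ l))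

/-- `Γ` solves the squared symmetric estimating equations. -/
def IsSquaredSymmetric (G : ℝ → ℝ) (n : ℕ) (x : ℕ → Fin p → ℝ)
    (Γ : Matrix (Fin p) (Fin p) ℝ) : Prop :=
  IsWhitening n x Γ ∧
    ∀ j l, Γ l ⬝ᵥ sampleT2 G n x (Γ j) = Γ j ⬝ᵥ sampleT2 G n x (Γ l)

end Sample

/-! ### Consistent sequences of estimates and asymptotic variances -/

section Asymptotics

variable {Ω : Type*} [MeasurableSpace Ω]

/-- `Γhat n` are random matrices that solve the estimating equations `Eqs` for the first `n`
observations with probability tending to one, and that converge in probability to the identity. -/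
structure IsConsistentSolution {p : ℕ} (P : Measure Ω)
    (Eqs : ℕ → (ℕ → Fin p → ℝ) → Matrix (Fin p) (Fin p) ℝ → Prop) (x : ℕ → Ω → Fin p → ℝ)
    (Γhat : ℕ → Ω → Matrix (Fin p) (Fin p) ℝ) : Prop where
  measurable : ∀ n a b, Measurable (fun ω => Γhat n ω a b)
  solves : Tendsto (fun n => P {ω | ¬ Eqs n (fun i => x i ω) (Γhat n ω)}) atTop (𝓝 0)
  consistent : ∀ a b, TendstoInMeasure P (fun n ω => Γhat n ω a b) atTop
    (fun _ => (1 : Matrix (Fin p) (Fin p) ℝ) a b)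

/-- `√n (est n - θ)` converges in distribution to `N(0, V)`. -/
def HasASV (P : Measure Ω) [IsProbabilityMeasure P] (est : ℕ → Ω → ℝ) (θ : ℝ) (V : ℝ≥0) : Prop :=
  TendstoInDistribution (fun (n : ℕ) (ω : Ω) => √(n : ℝ) * (est n ω - θ)) atTop
    (id : ℝ → ℝ) (fun _ => P) (gaussianReal 0 V)

/-- The entries `(j, l)` and `(l, j)` of `Γhat`, as estimates of the entries of the identity matrix,
have asymptotic variances whose sum is `c`. -/
def HasASVSum {p : ℕ} (P : Measure Ω) [IsProbabilityMeasure P]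
    (Γhat : ℕ → Ω → Matrix (Fin p) (Fin p) ℝ) (j l : Fin p) (c : ℝ) : Prop :=
  ∃ V W : ℝ≥0,
    HasASV P (fun n ω => Γhat n ω j l) ((1 : Matrix (Fin p) (Fin p) ℝ) j l) V ∧
    HasASV P (fun n ω => Γhat n ω l j) ((1 : Matrix (Fin p) (Fin p) ℝ) l j) W ∧
    (V : ℝ) + (W : ℝ) = c

end Asymptotics

/-- `(b_j/(b_j+b_l))² (2α_j+1) + (b_l/(b_j+b_l))² (2α_l+1)`. -/
noncomputable def weighted (bj bl αj αl : ℝ) : ℝ :=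
  (bj / (bj + bl)) ^ 2 * (2 * αj + 1) + (bl / (bj + bl)) ^ 2 * (2 * αl + 1)

end FastICA

open FastICA

open Asymptotics

/-! Near the identity the estimating equations are linear to first order. Let C_jl be the centred
empirical mean of z_j z_l, and Q_jl the empirical mean of (g(z_j) - E g(z_j)) z_l. The constraint
gives γ_jl + γ_lj ≈ -C_jl. For j ≠ l a Taylor expansion of g gives T(γ_j)_l ≈ Q_jl + δ_j γ_jl, hence
γ_lᵀT(γ_j) ≈ Q_jl + δ_j γ_jl + λ_j γ_lj. In the deflation-based equations the earlier rows drop out,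
and (λ_j - δ_j) γ_jl ≈ Q_jl - λ_j C_jl for j < l. Both symmetric versions have the form a_j
γ_lᵀT(γ_j) = a_l γ_jᵀT(γ_l); with β_k = lim a_k (λ_k - δ_k), eliminating γ_lj leaves (β_j + β_l)
γ_jl ≈ a_j (Q_jl - λ_j C_jl) - a_l (Q_lj - δ_l C_jl).

The right sides are empirical means of combinations of u_j(z_j) z_l, u_l(z_l) z_j and z_j z_l, where
u_k(z_k) is the residual of g(z_k) after regression on 1 and z_k. These three products are
uncorrelated, with second moments σ_j² - λ_j², σ_l² - λ_l² and 1 (`integral_influence_sq`). The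
central limit theorem and addition of the two variances give the formula.

The estimates are only assumed consistent, so their root-n rate has to be proved. All errors are
negligible against ρ plus the size of the deviations themselves, where ρ is a random rate of order
n^(-1/2) that bounds C, the off-diagonal Q and the sample mean of z. Nondegeneracy of the linear
system allows the deviations to be absorbed (`isBigO_sum_of_isLittleO_self`): row by row in
`deflation_rowScale`, all entries at once in `symmetric_rowScale`. The expansions
(`exists_isFirstOrder`) rest on the law of large numbers and on a Taylor bound uniform in the
direction (`isLittleO_empMean_taylor`). Convergence in probability is convergence along
`probFilter`, so that the o/O calculus of filters applies as it stands. -/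

namespace FastICA

/-! ### Stochastic order symbols as order symbols along a filter -/

section ProbFilter

variable {Ω : Type*} [MeasurableSpace Ω] {P : Measure Ω}

/-- The filter of the sequences of events whose probability tends to one.  Convergence in
probability is convergence along this filter. -/
def probFilter (P : Measure Ω) : Filter (ℕ × Ω) where
  sets := {A | Tendsto (fun n => P {ω | (n, ω) ∉ A}) atTop (𝓝 0)}
  univ_sets := by simp
  sets_of_superset := by
    intro A B hA hAB
    exact tendsto_of_tendsto_of_tendsto_of_le_of_le tendsto_const_nhds hA (fun _ => zero_le)
      (fun n => measure_mono fun ω hω h => hω (hAB h))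
  inter_sets := by
    intro A B hA hB
    have h : Tendsto (fun n => P {ω | (n, ω) ∉ A} + P {ω | (n, ω) ∉ B}) atTop (𝓝 0) := by
      simpa using Tendsto.add hA hB
    refine tendsto_of_tendsto_of_tendsto_of_le_of_le tendsto_const_nhds h (fun _ => zero_le)
      (fun n => (measure_mono ?_).trans (measure_union_le _ _))
    intro ω hω
    by_cases h : (n, ω) ∈ A
    · exact Or.inr fun h' => hω ⟨h, h'⟩
    · exact Or.inl h

theorem eventually_probFilter {C : ℕ × Ω → Prop} :
    (∀ᶠ q in probFilter P, C q) ↔ Tendsto (fun n => P {ω | ¬ C (n, ω)}) atTop (𝓝 0) :=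
  Iff.rfl

theorem tendsto_fst_probFilter : Tendsto Prod.fst (probFilter P) atTop := by
  intro A hA
  obtain ⟨N, hN⟩ := mem_atTop_sets.1 hA
  refine eventually_probFilter.2 (tendsto_const_nhds.congr' ?_)
  filter_upwards [eventually_ge_atTop N] with n hn
  simp [hN n hn]

theorem tendstoInMeasure_iff_probFilter {f : ℕ → Ω → ℝ} {g : Ω → ℝ} :
    TendstoInMeasure P f atTop g ↔
      Tendsto (fun q : ℕ × Ω => f q.1 q.2 - g q.2) (probFilter P) (𝓝 0) := by
  rw [tendstoInMeasure_iff_norm, Metric.tendsto_nhds]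
  simp only [eventually_probFilter, dist_zero_right, not_lt]

theorem eventually_pos_probFilter : ∀ᶠ q in probFilter P, 0 < (q.1 : ℝ) := by
  filter_upwards [tendsto_fst_probFilter.eventually (eventually_gt_atTop 0)] with q hq
  exact_mod_cast hq

theorem tendsto_inv_sqrt_probFilter :
    Tendsto (fun q : ℕ × Ω => (√(q.1 : ℝ))⁻¹) (probFilter P) (𝓝 0) :=
  (tendsto_inv_atTop_zero.comp
    (Real.tendsto_sqrt_atTop.comp tendsto_natCast_atTop_atTop)).comp tendsto_fst_probFilter

/-- Boundedness in probability, expressed through products with variables that tend to zero in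
probability. -/
def Tight (P : Measure Ω) (R : ℕ × Ω → ℝ) : Prop :=
  ∀ Y : ℕ × Ω → ℝ, Tendsto Y (probFilter P) (𝓝 0) →
    Tendsto (fun q => Y q * R q) (probFilter P) (𝓝 0)

theorem Tight.abs {R : ℕ × Ω → ℝ} (hR : Tight P R) : Tight P fun q => |R q| := fun Y hY => by
  rw [tendsto_zero_iff_abs_tendsto_zero]
  simpa [Function.comp_def, abs_mul] using (hR Y hY).abs

theorem Tight.sum {ι : Type*} (s : Finset ι) {R : ι → ℕ × Ω → ℝ} (hR : ∀ i ∈ s, Tight P (R i)) :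
    Tight P fun q => ∑ i ∈ s, R i q := fun Y hY => by
  simpa [Finset.mul_sum] using tendsto_finsetSum s fun i hi => hR i hi Y hY

/-- A sequence with bounded second moments is tight. -/
theorem tight_of_integral_sq_le {R : ℕ × Ω → ℝ} [IsFiniteMeasure P] {C : ℝ}
    (hR : ∀ n, MemLp (fun ω => R (n, ω)) 2 P) (hC : ∀ n, ∫ ω, R (n, ω) ^ 2 ∂P ≤ C) :
    Tight P R := by
  intro Y hY
  rw [Metric.tendsto_nhds]
  intro ε hε
  simp only [dist_zero_right, Real.norm_eq_abs, abs_mul]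
  have hC0 : 0 ≤ C := (integral_nonneg fun ω => sq_nonneg _).trans (hC 0)
  rw [eventually_probFilter, ENNReal.tendsto_nhds_zero]
  intro η hη
  by_cases hη' : η = ⊤
  · simp [hη']
  -- Chebyshev bounds P(|R| ≥ K) by C / K², and K makes this at most η / 2; the other half of η is
  -- spent on the event |Y| ≥ ε / K.
  obtain ⟨K, hK, hKη⟩ : ∃ K : ℝ, 0 < K ∧ ENNReal.ofReal (C / K ^ 2) ≤ η / 2 := by
    have h0 : Tendsto (fun K : ℝ => ENNReal.ofReal (C / K ^ 2)) atTop (𝓝 0) := by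
      have := ENNReal.tendsto_ofReal
        (tendsto_const_nhds (x := C).div_atTop (tendsto_pow_atTop (α := ℝ) two_ne_zero))
      simpa using this
    obtain ⟨K, h1, h2⟩ := ((ENNReal.tendsto_nhds_zero.1 h0 (η / 2)
      (ENNReal.half_pos hη.ne')).and (eventually_gt_atTop 0)).exists
    exact ⟨K, h2, h1⟩
  have hYe : ∀ᶠ q in probFilter P, |Y q| < ε / K := by
    simpa using (Metric.tendsto_nhds.1 hY) (ε / K) (by positivity)
  rw [eventually_probFilter, ENNReal.tendsto_nhds_zero] at hYe
  filter_upwards [hYe (η / 2) (ENNReal.half_pos hη.ne')] with n hn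
  have hcheb : P {ω | K ≤ |R (n, ω)|} ≤ ENNReal.ofReal (C / K ^ 2) := by
    have hi : Integrable (fun ω => R (n, ω) ^ 2) P := (hR n).integrable_sq
    have := mul_meas_ge_le_integral_of_nonneg (μ := P) (f := fun ω => R (n, ω) ^ 2)
      (Eventually.of_forall fun ω => sq_nonneg _) hi (K ^ 2)
    have hsub : {ω | K ≤ |R (n, ω)|} ⊆ {ω | K ^ 2 ≤ R (n, ω) ^ 2} := fun ω hω => by
      have : K ^ 2 ≤ |R (n, ω)| ^ 2 := pow_le_pow_left₀ hK.le hω 2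
      simpa using this
    refine (measure_mono hsub).trans ?_
    rw [← ENNReal.ofReal_toReal (measure_ne_top P {ω | K ^ 2 ≤ R (n, ω) ^ 2})]
    apply ENNReal.ofReal_le_ofReal
    rw [le_div_iff₀ (by positivity), mul_comm]
    exact this.trans (hC n)
  calc P {ω | ¬ |Y (n, ω)| * |R (n, ω)| < ε}
      ≤ P ({ω | ¬ |Y (n, ω)| < ε / K} ∪ {ω | K ≤ |R (n, ω)|}) := by
        refine measure_mono fun ω hω => ?_
        by_contra hcon
        simp only [Set.mem_union, Set.mem_ofPred_eq, not_or, not_not, not_le] at hcon hω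
        apply hω
        calc |Y (n, ω)| * |R (n, ω)| ≤ |Y (n, ω)| * K := by gcongr; exact hcon.2.le
          _ < ε / K * K := by gcongr; exact hcon.1
          _ = ε := by field_simp
    _ ≤ η / 2 + η / 2 := (measure_union_le _ _).trans (add_le_add hn (hcheb.trans hKη))
    _ = η := ENNReal.add_halves η

/-- A common rate for finitely many root-`n` consistent sequences. -/
theorem exists_rate {ι : Type*} [Fintype ι] {f : ι → ℕ × Ω → ℝ}
    (hf : ∀ i, Tight P fun q => √(q.1 : ℝ) * f i q) :
    ∃ ρ : ℕ × Ω → ℝ, (∀ i, f i =O[probFilter P] ρ) ∧ Tendsto ρ (probFilter P) (𝓝 0) ∧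
      ∀ h : ℕ × Ω → ℝ, h =o[probFilter P] ρ →
        Tendsto (fun q => √(q.1 : ℝ) * h q) (probFilter P) (𝓝 0) := by
  set R : ℕ × Ω → ℝ := fun q => ∑ i, |√(q.1 : ℝ) * f i q| with hRdef
  have hR : Tight P R := Tight.sum _ fun i _ => (hf i).abs
  -- The rate is random. The deterministic n^(-1/2) would not do: `=O[probFilter P]` asks for one
  -- constant that works with probability tending to one, which is more than boundedness in
  -- probability.
  refine ⟨fun q => (√(q.1 : ℝ))⁻¹ * R q, fun i => ?_, hR _ tendsto_inv_sqrt_probFilter, ?_⟩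
  · refine IsBigO.of_bound 1 ?_
    filter_upwards [eventually_pos_probFilter] with q hq
    have hs : 0 < √(q.1 : ℝ) := Real.sqrt_pos.2 hq
    have h1 : |√(q.1 : ℝ) * f i q| ≤ R q :=
      Finset.single_le_sum (f := fun i => |√(q.1 : ℝ) * f i q|) (fun _ _ => abs_nonneg _)
        (Finset.mem_univ i)
    have h2 : 0 ≤ R q := (abs_nonneg _).trans h1
    rw [Real.norm_eq_abs, Real.norm_eq_abs, one_mul, abs_of_nonneg (mul_nonneg (inv_nonneg.2 hs.le) h2),
      ← div_eq_inv_mul, le_div_iff₀ hs, mul_comm]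
    nth_rw 1 [← abs_of_pos hs]
    rw [← abs_mul]
    exact h1
  · intro h hh
    have h1 : (fun q : ℕ × Ω => √(q.1 : ℝ) * h q) =o[probFilter P] R := by
      have h2 := (isBigO_refl (fun q : ℕ × Ω => √(q.1 : ℝ)) (probFilter P)).mul_isLittleO hh
      refine h2.congr' EventuallyEq.rfl ?_
      filter_upwards [eventually_pos_probFilter] with q hq
      have hs : 0 < √(q.1 : ℝ) := Real.sqrt_pos.2 hq
      field_simp
    obtain ⟨φ, hφ, hφe⟩ := h1.exists_eq_mul
    exact (hR φ hφ).congr' hφe.symm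

end ProbFilter

/-! ### Empirical means of functions of the sample -/

section EmpMean

variable {Ω : Type*} {p : ℕ} {z : ℕ → Ω → Fin p → ℝ}

/-- The mean of `ψ` under the empirical distribution of the first `n` latent vectors. -/
noncomputable def empMean (z : ℕ → Ω → Fin p → ℝ) (ψ : (Fin p → ℝ) → ℝ) (q : ℕ × Ω) : ℝ :=
  (q.1 : ℝ)⁻¹ * ∑ i ∈ Finset.range q.1, ψ (z i q.2)

theorem empMean_add (φ ψ : (Fin p → ℝ) → ℝ) (q : ℕ × Ω) :
    empMean z (fun v => φ v + ψ v) q = empMean z φ q + empMean z ψ q := by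
  simp [empMean, Finset.sum_add_distrib, mul_add]

theorem empMean_sub (φ ψ : (Fin p → ℝ) → ℝ) (q : ℕ × Ω) :
    empMean z (fun v => φ v - ψ v) q = empMean z φ q - empMean z ψ q := by
  simp [empMean, Finset.sum_sub_distrib, mul_sub]

theorem empMean_const_mul (c : ℝ) (ψ : (Fin p → ℝ) → ℝ) (q : ℕ × Ω) :
    empMean z (fun v => c * ψ v) q = c * empMean z ψ q := by
  simp [empMean, ← Finset.mul_sum, mul_left_comm]

theorem empMean_const {q : ℕ × Ω} (hq : 0 < (q.1 : ℝ)) (c : ℝ) :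
    empMean z (fun _ => c) q = c := by
  simp only [empMean, Finset.sum_const, Finset.card_range, nsmul_eq_mul]
  field_simp

theorem empMean_sum {ι : Type*} (s : Finset ι) (ψ : ι → (Fin p → ℝ) → ℝ) (q : ℕ × Ω) :
    empMean z (fun v => ∑ m ∈ s, ψ m v) q = ∑ m ∈ s, empMean z (ψ m) q := by
  simp only [empMean, Finset.mul_sum]
  rw [Finset.sum_comm]

theorem abs_empMean_le {φ ψ : (Fin p → ℝ) → ℝ} {q : ℕ × Ω}
    (h : ∀ i < q.1, |φ (z i q.2)| ≤ ψ (z i q.2)) : |empMean z φ q| ≤ empMean z ψ q := by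
  rw [empMean, empMean, abs_mul, abs_of_nonneg (by positivity : 0 ≤ (q.1 : ℝ)⁻¹)]
  gcongr
  exact (Finset.abs_sum_le_sum_abs _ _).trans
    (Finset.sum_le_sum fun i hi => h i (Finset.mem_range.1 hi))

variable [MeasurableSpace Ω] {P : Measure Ω}

theorem IsIIDSample.identDistrib_comp (hz : IsIIDSample P z) {ψ : (Fin p → ℝ) → ℝ}
    (hψ : Measurable ψ) (i : ℕ) :
    IdentDistrib (fun ω => ψ (z i ω)) (fun ω => ψ (z 0 ω)) P P :=
  (hz.identDistrib i).comp hψ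

theorem IsIIDSample.indep_comp (hz : IsIIDSample P z) {ψ : (Fin p → ℝ) → ℝ} (hψ : Measurable ψ) :
    iIndepFun (fun i ω => ψ (z i ω)) P :=
  hz.indep.comp (fun _ => ψ) fun _ => hψ

theorem IsIIDSample.measurable_empMean (hz : IsIIDSample P z) {ψ : (Fin p → ℝ) → ℝ}
    (hψ : Measurable ψ) (n : ℕ) : Measurable fun ω => empMean z ψ (n, ω) := by
  simp only [empMean]
  exact (Finset.measurable_fun_sum _ fun i _ => hψ.comp (hz.measurable i)).const_mul _

variable [IsProbabilityMeasure P]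

/-- The weak law of large numbers. -/
theorem IsIIDSample.tendsto_empMean (hz : IsIIDSample P z) {ψ : (Fin p → ℝ) → ℝ}
    (hψ : Measurable ψ) (hi : Integrable (fun ω => ψ (z 0 ω)) P) :
    Tendsto (empMean z ψ) (probFilter P) (𝓝 (∫ ω, ψ (z 0 ω) ∂P)) := by
  have h := strong_law_ae (μ := P) (fun i ω => ψ (z i ω)) hi
    (fun i k hik => (hz.indep_comp hψ).indepFun hik) (hz.identDistrib_comp hψ)
  have h2 := tendstoInMeasure_iff_probFilter.1 (tendstoInMeasure_of_tendsto_ae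
    (fun n => (hz.measurable_empMean hψ n).aestronglyMeasurable) h)
  simpa using h2.add_const (∫ ω, ψ (z 0 ω) ∂P)

/-- The terms are centred and pairwise independent, so for n ≥ 1 the second moment of the rescaled
mean is the variance of a single term; for n = 0 it is zero. -/
theorem IsIIDSample.tight_empMean (hz : IsIIDSample P z) {ψ : (Fin p → ℝ) → ℝ}
    (hψ : Measurable ψ) (h2 : MemLp (fun ω => ψ (z 0 ω)) 2 P) (h0 : ∫ ω, ψ (z 0 ω) ∂P = 0) :
    Tight P fun q => √(q.1 : ℝ) * empMean z ψ q := by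
  have hL : ∀ i, MemLp (fun ω => ψ (z i ω)) 2 P := fun i =>
    (hz.identDistrib_comp hψ i).memLp_iff.2 h2
  have hS : ∀ n, MemLp (fun ω => ∑ i ∈ Finset.range n, ψ (z i ω)) 2 P := fun n =>
    memLp_finsetSum _ fun i _ => hL i
  have hE : ∀ n, MemLp (fun ω => empMean z ψ (n, ω)) 2 P := fun n => by
    simpa only [empMean] using (hS n).const_mul _
  refine tight_of_integral_sq_le (C := variance (fun ω => ψ (z 0 ω)) P)
    (fun n => (hE n).const_mul (√(n : ℝ))) fun n => ?_
  have hmean : ∫ ω, ∑ i ∈ Finset.range n, ψ (z i ω) ∂P = 0 := by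
    rw [integral_finsetSum _ fun i _ => (hL i).integrable one_le_two]
    exact Finset.sum_eq_zero fun i _ => (hz.identDistrib_comp hψ i).integral_eq.trans h0
  have hvar : ∫ ω, (∑ i ∈ Finset.range n, ψ (z i ω)) ^ 2 ∂P
      = n * variance (fun ω => ψ (z 0 ω)) P := by
    rw [← variance_of_integral_eq_zero (hS n).aestronglyMeasurable.aemeasurable hmean]
    have := IndepFun.variance_sum (μ := P) (X := fun i ω => ψ (z i ω)) (s := Finset.range n)
      (fun i _ => hL i) (fun i _ k _ hik => (hz.indep_comp hψ).indepFun hik)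
    have h' : (∑ i ∈ Finset.range n, fun ω => ψ (z i ω))
        = fun ω => ∑ i ∈ Finset.range n, ψ (z i ω) := by ext; simp
    rw [h'] at this
    rw [this, Finset.sum_congr rfl fun i _ => (hz.identDistrib_comp hψ i).variance_eq]
    simp
  have h3 : ∀ ω, (√(n : ℝ) * empMean z ψ (n, ω)) ^ 2
      = (n : ℝ)⁻¹ * (∑ i ∈ Finset.range n, ψ (z i ω)) ^ 2 := fun ω => by
    rcases n.eq_zero_or_pos with rfl | hn
    · simp
    rw [empMean, mul_pow, Real.sq_sqrt (Nat.cast_nonneg n), mul_pow]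
    have : (n : ℝ) ≠ 0 := by positivity
    field_simp
  simp only [h3]
  rw [integral_const_mul, hvar]
  rcases n.eq_zero_or_pos with rfl | hn
  · simp [variance_nonneg]
  · have : (n : ℝ) ≠ 0 := by positivity
    rw [inv_mul_cancel_left₀ this]

/-- An estimate that is asymptotically equivalent to an empirical mean is asymptotically normal. -/
theorem IsIIDSample.hasASV (hz : IsIIDSample P z) {ψ : (Fin p → ℝ) → ℝ} (hψ : Measurable ψ)
    (h2 : MemLp (fun ω => ψ (z 0 ω)) 2 P) (h0 : ∫ ω, ψ (z 0 ω) ∂P = 0) {est : ℕ → Ω → ℝ} {θ : ℝ}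
    (hest : ∀ n, Measurable (est n))
    (h : Tendsto (fun q : ℕ × Ω => √(q.1 : ℝ) * (est q.1 q.2 - θ - empMean z ψ q)) (probFilter P)
      (𝓝 0)) :
    HasASV P est θ (∫ ω, ψ (z 0 ω) ^ 2 ∂P).toNNReal := by
  have hvar : variance (fun ω => ψ (z 0 ω)) P = ∫ ω, ψ (z 0 ω) ^ 2 ∂P :=
    variance_of_integral_eq_zero h2.aestronglyMeasurable.aemeasurable h0
  have hclt := tendstoInDistribution_inv_sqrt_mul_sum_sub (P := P) (X := fun i ω => ψ (z i ω))
    (Y := (id : ℝ → ℝ)) (P' := gaussianReal 0 (∫ ω, ψ (z 0 ω) ^ 2 ∂P).toNNReal)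
    (by rw [hvar]; exact HasLaw.id) h2 (hz.indep_comp hψ) (hz.identDistrib_comp hψ)
  -- Slutsky: the difference from the normalised sum tends to zero in probability.
  refine tendstoInDistribution_of_tendstoInMeasure_sub _ _ hclt ?_
    fun n => (((hest n).sub_const θ).const_mul _).aemeasurable
  refine tendstoInMeasure_iff_probFilter.2 (h.congr' ?_)
  filter_upwards [eventually_pos_probFilter] with q hq
  have hs : 0 < √(q.1 : ℝ) := Real.sqrt_pos.2 hq
  have : (√(q.1 : ℝ))⁻¹ = √(q.1 : ℝ) * (q.1 : ℝ)⁻¹ := by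
    rw [← div_eq_mul_inv, Real.sqrt_div_self', one_div]
  simp only [Pi.sub_apply, Pi.zero_apply, sub_zero, h0, mul_zero, this, empMean]
  ring

end EmpMean

/-! ### Taylor expansion of the nonlinearity -/

section Taylor

theorem IsContrast.differentiable {G : ℝ → ℝ} (hG : IsContrast G) : Differentiable ℝ G :=
  hG.contDiff.differentiable (by norm_num)

theorem IsContrast.contDiff_deriv {G : ℝ → ℝ} (hG : IsContrast G) : ContDiff ℝ 1 (deriv G) :=
  ((contDiff_succ_iff_deriv (n := 1)).1 (by simpa [one_add_one_eq_two] using hG.contDiff)).2.2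

theorem IsContrast.differentiable_deriv {G : ℝ → ℝ} (hG : IsContrast G) :
    Differentiable ℝ (deriv G) :=
  hG.contDiff_deriv.differentiable (by norm_num)

theorem IsContrast.continuous_deriv {G : ℝ → ℝ} (hG : IsContrast G) : Continuous (deriv G) :=
  hG.contDiff_deriv.continuous

theorem IsContrast.continuous_deriv_deriv {G : ℝ → ℝ} (hG : IsContrast G) :
    Continuous (deriv (deriv G)) :=
  hG.contDiff_deriv.continuous_deriv le_rfl

/-- Mean value inequality for ξ ↦ f ξ - f'(x) ξ on the ball of radius |y - x|. No second derivative
of f enters, so that for f = g the continuity of g' is enough. -/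
theorem abs_sub_sub_le_of_abs_deriv_sub_le {f : ℝ → ℝ} (hf : Differentiable ℝ f) {x y C : ℝ}
    (hC : ∀ ξ, |ξ - x| ≤ |y - x| → |deriv f ξ - deriv f x| ≤ C) :
    |f y - f x - deriv f x * (y - x)| ≤ C * |y - x| := by
  have h := Convex.norm_image_sub_le_of_norm_hasDerivWithin_le
    (f := fun ξ => f ξ - deriv f x * ξ) (f' := fun ξ => deriv f ξ - deriv f x) (C := C)
    (s := Metric.closedBall x |y - x|) (x := x) (y := y)
    (fun ξ _ => (((hf ξ).hasDerivAt).sub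
      (by simpa using (hasDerivAt_id ξ).const_mul (deriv f x))).hasDerivWithinAt)
    (fun ξ hξ => hC ξ (by simpa [Real.dist_eq] using hξ)) (convex_closedBall _ _)
    (by simp) (by simp [Real.dist_eq])
  rw [Real.norm_eq_abs, Real.norm_eq_abs] at h
  convert! h using 2
  ring

/-! ### Weights, weighted moduli of continuity and domination of g' -/

variable {p : ℕ}

/-- A weight that dominates the affine functions with coefficients of modulus at most one. -/
def weight (v : Fin p → ℝ) : ℝ := 1 + ∑ m, |v m|

theorem one_le_weight (v : Fin p → ℝ) : 1 ≤ weight v := by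
  have : 0 ≤ ∑ m, |v m| := Finset.sum_nonneg fun _ _ => abs_nonneg _
  unfold weight
  linarith

theorem weight_pos (v : Fin p → ℝ) : 0 < weight v := one_pos.trans_le (one_le_weight v)

theorem abs_le_weight (v : Fin p → ℝ) (m : Fin p) : |v m| ≤ weight v := by
  have : |v m| ≤ ∑ m, |v m| :=
    Finset.single_le_sum (f := fun m => |v m|) (fun _ _ => abs_nonneg _) (Finset.mem_univ m)
  unfold weight
  linarith

theorem continuous_weight : Continuous (weight : (Fin p → ℝ) → ℝ) := by
  unfold weight
  fun_prop

/-- Links `weight` to the factor 1 + ‖v‖² of `LocallyDominated`. The norm is the supremum norm,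
hence the power of p. -/
theorem weight_sq_le (v : Fin p → ℝ) : weight v ^ 2 ≤ 2 * (1 + (p : ℝ) ^ 2) * (1 + ‖v‖ ^ 2) := by
  have h : ∑ m, |v m| ≤ p * ‖v‖ := by
    have := Finset.sum_le_card_nsmul Finset.univ (fun m => |v m|) ‖v‖
      (fun m _ => by simpa using norm_le_pi_norm v m)
    simpa using this
  have h0 : 0 ≤ ∑ m, |v m| := Finset.sum_nonneg fun _ _ => abs_nonneg _
  have h1 : (∑ m, |v m|) ^ 2 ≤ (p * ‖v‖) ^ 2 := pow_le_pow_left₀ h0 h 2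
  unfold weight
  nlinarith [sq_nonneg (1 - ∑ m, |v m|), sq_nonneg (p : ℝ), sq_nonneg ‖v‖]

theorem abs_dotProduct_add_sub_le (u v : Fin p → ℝ) (t : ℝ) (k : Fin p) :
    |u ⬝ᵥ v + t - v k| ≤ (∑ m, |u m - (1 : Matrix (Fin p) (Fin p) ℝ) k m| + |t|) * weight v := by
  have h1 : u ⬝ᵥ v - v k = ∑ m, (u m - (1 : Matrix (Fin p) (Fin p) ℝ) k m) * v m := by
    simp [dotProduct, sub_mul, Matrix.one_apply]
  have h2 : |∑ m, (u m - (1 : Matrix (Fin p) (Fin p) ℝ) k m) * v m|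
      ≤ ∑ m, |u m - (1 : Matrix (Fin p) (Fin p) ℝ) k m| * weight v := by
    refine (Finset.abs_sum_le_sum_abs _ _).trans (Finset.sum_le_sum fun m _ => ?_)
    rw [abs_mul]
    gcongr
    exact abs_le_weight v m
  have h3 : |t| ≤ |t| * weight v := le_mul_of_one_le_right (abs_nonneg t) (one_le_weight v)
  calc |u ⬝ᵥ v + t - v k| = |(u ⬝ᵥ v - v k) + t| := by ring_nf
    _ ≤ |u ⬝ᵥ v - v k| + |t| := abs_add_le _ _
    _ ≤ _ := by
      rw [h1, add_mul, Finset.sum_mul]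
      exact add_le_add h2 h3

/-- The weighted modulus of continuity of `f` around the `k`th coordinate. -/
noncomputable def modulus (f : ℝ → ℝ) (k : Fin p) (η : ℝ) (v : Fin p → ℝ) : ℝ :=
  sSup ((fun θ => |f (v k + θ * (η * weight v)) - f (v k)|) '' Set.Icc (-1) 1) * weight v ^ 2

/-- The supremum runs over θ in the fixed compact interval [-1, 1] rather than over a ball depending
on v; continuity in v, and with it measurability, then comes from compactness. -/
theorem continuous_modulus {f : ℝ → ℝ} (hf : Continuous f) (k : Fin p) (η : ℝ) :
    Continuous (modulus f k η) := by
  refine Continuous.mul ?_ (continuous_weight.pow 2)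
  refine isCompact_Icc.continuous_sSup
    (f := fun (v : Fin p → ℝ) (θ : ℝ) => |f (v k + θ * (η * weight v)) - f (v k)|) ?_
  have := continuous_weight (p := p)
  simp only [Function.HasUncurry.uncurry, id]
  fun_prop

theorem abs_sub_mul_le_modulus {f : ℝ → ℝ} (hf : Continuous f) (k : Fin p) {η : ℝ} (hη : 0 < η)
    (v : Fin p → ℝ) {y : ℝ} (hy : |y - v k| ≤ η * weight v) :
    |f y - f (v k)| * weight v ^ 2 ≤ modulus f k η v := by
  have hw := weight_pos v
  have hbdd : BddAbove ((fun θ => |f (v k + θ * (η * weight v)) - f (v k)|) '' Set.Icc (-1) 1) :=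
    (isCompact_Icc.image (by fun_prop)).bddAbove
  unfold modulus
  gcongr
  refine le_csSup hbdd ⟨(y - v k) / (η * weight v), ?_, ?_⟩
  · rw [Set.mem_Icc, ← abs_le, abs_div, abs_of_pos (by positivity : 0 < η * weight v)]
    exact div_le_one_of_le₀ hy (by positivity)
  · have : η * weight v ≠ 0 := by positivity
    simp only [div_mul_cancel₀ _ this]
    ring_nf

theorem modulus_nonneg (f : ℝ → ℝ) (k : Fin p) (η : ℝ) (v : Fin p → ℝ) : 0 ≤ modulus f k η v :=
  mul_nonneg (Real.sSup_nonneg (by rintro _ ⟨θ, _, rfl⟩; exact abs_nonneg _)) (sq_nonneg _)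

theorem modulus_le {f : ℝ → ℝ} (k : Fin p) {η C : ℝ} (hη : 0 ≤ η) (v : Fin p → ℝ)
    (h : ∀ y, |y - v k| ≤ η * weight v → |f y - f (v k)| * weight v ^ 2 ≤ C) :
    modulus f k η v ≤ C := by
  have hw := weight_pos v
  unfold modulus
  rw [← le_div_iff₀ (by positivity)]
  refine csSup_le ((Set.nonempty_Icc.2 (by norm_num)).image _) ?_
  rintro _ ⟨θ, hθ, rfl⟩
  rw [le_div_iff₀ (by positivity)]
  refine h _ ?_
  rw [add_sub_cancel_left, abs_mul, abs_of_nonneg (by positivity : 0 ≤ η * weight v)]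
  exact mul_le_of_le_one_left (by positivity) (abs_le.2 hθ)

theorem tendsto_modulus {f : ℝ → ℝ} (hf : Continuous f) (k : Fin p) (v : Fin p → ℝ) {r : ℝ}
    (hr : 0 < r) : Tendsto (fun n : ℕ => modulus f k (r / (n + 1)) v) atTop (𝓝 0) := by
  have hw := weight_pos v
  rw [Metric.tendsto_atTop]
  intro ε hε
  obtain ⟨d, hd, hfd⟩ := Metric.continuousAt_iff.1 (hf.continuousAt (x := v k))
    (ε / 2 / weight v ^ 2) (by positivity)
  have ht : Tendsto (fun n : ℕ => r / ((n : ℝ) + 1) * weight v) atTop (𝓝 0) := by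
    have := ((tendsto_one_div_add_atTop_nhds_zero_nat (𝕜 := ℝ)).const_mul r).mul_const (weight v)
    simpa [div_eq_mul_inv] using this
  obtain ⟨n₀, hn₀⟩ := Filter.eventually_atTop.1 (ht.eventually_lt_const hd)
  refine ⟨n₀, fun n hn => ?_⟩
  rw [Real.dist_eq, sub_zero, abs_of_nonneg (modulus_nonneg _ _ _ _)]
  refine (modulus_le k (by positivity) v fun y hy => ?_).trans_lt (half_lt_self hε)
  have := hfd (show dist y (v k) < d from (Real.dist_eq y _).trans_lt (hy.trans_lt (hn₀ n hn)))
  rw [Real.dist_eq, lt_div_iff₀ (by positivity)] at this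
  exact this.le

variable {Ω : Type*} [MeasurableSpace Ω] {P : Measure Ω} {G : ℝ → ℝ} {Z : Ω → Fin p → ℝ}

/-- Every y within r · weight(Z) of Z_k has the form uᵀZ + t with (u, t) in the range of the
hypothesis. Here u depends on ω, which is harmless because the hypothesis holds for all u and t
outside one null set. -/
theorem LocallyDominated.exists_integrable_bound (h : LocallyDominated P G Z) (k : Fin p) :
    ∃ r > 0, ∃ M : Ω → ℝ, Integrable M P ∧ ∀ᵐ ω ∂P, ∀ y, |y - Z ω k| ≤ r * weight (Z ω) →
      |deriv (deriv G) y| * weight (Z ω) ^ 2 ≤ M ω := by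
  obtain ⟨r, hr, M, hM, hae⟩ := h k
  refine ⟨r, hr, fun ω => 2 * (1 + (p : ℝ) ^ 2) * M ω, hM.const_mul _, ?_⟩
  filter_upwards [hae] with ω hω y hy
  have hw := weight_pos (Z ω)
  set θ : ℝ := (y - Z ω k) / weight (Z ω) with hθ
  have hθr : |θ| ≤ r := by
    rw [hθ, abs_div, abs_of_pos hw]
    exact div_le_of_le_mul₀ hw.le hr.le hy
  -- Each coordinate of e_k moves by θ in the direction of the sign of Z_m, and the shift is θ as
  -- well; uᵀZ + t then exceeds Z_k by θ (1 + ∑ |Z_m|) = y - Z_k.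
  set s : Fin p → ℝ := fun m => if 0 ≤ Z ω m then θ else -θ with hs
  have hsZ : ∀ m, s m * Z ω m = θ * |Z ω m| := fun m => by
    by_cases h0 : 0 ≤ Z ω m
    · simp [hs, h0, abs_of_nonneg h0]
    · simp [hs, h0, abs_of_neg (not_le.1 h0)]
  have hy' : (Pi.single k 1 + s) ⬝ᵥ Z ω + θ = y := by
    rw [add_dotProduct, single_dotProduct, one_mul]
    have : s ⬝ᵥ Z ω = θ * ∑ m, |Z ω m| := by
      rw [dotProduct, Finset.mul_sum]
      exact Finset.sum_congr rfl fun m _ => hsZ m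
    have h2 : θ * weight (Z ω) = y - Z ω k := div_mul_cancel₀ _ hw.ne'
    rw [this]
    unfold weight at h2
    linarith
  have h1 := hω (Pi.single k 1 + s) θ (by
    rw [add_sub_cancel_left]
    refine (pi_norm_le_iff_of_nonneg hr.le).2 fun m => ?_
    by_cases h0 : 0 ≤ Z ω m
    · simpa [hs, h0] using hθr
    · simpa [hs, h0] using hθr) hθr
  rw [hy'] at h1
  calc |deriv (deriv G) y| * weight (Z ω) ^ 2
      ≤ |deriv (deriv G) y| * (2 * (1 + (p : ℝ) ^ 2) * (1 + ‖Z ω‖ ^ 2)) := by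
        gcongr
        exact weight_sq_le _
    _ = 2 * (1 + (p : ℝ) ^ 2) * (|deriv (deriv G) y| * (1 + ‖Z ω‖ ^ 2)) := by ring
    _ ≤ _ := by gcongr

theorem LocallyDominated.integrable_deriv_mul (h : LocallyDominated P G Z) (hG : IsContrast G)
    (hZ : Measurable Z) (k : Fin p) {φ : (Fin p → ℝ) → ℝ} (hφ : Measurable φ)
    (hφw : ∀ v, |φ v| ≤ weight v ^ 2) :
    Integrable (fun ω => deriv (deriv G) (Z ω k) * φ (Z ω)) P := by
  obtain ⟨r, hr, M, hM, hae⟩ := h.exists_integrable_bound k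
  have hm : Measurable fun ω => deriv (deriv G) (Z ω k) * φ (Z ω) :=
    (hG.continuous_deriv_deriv.measurable.comp ((measurable_pi_apply k).comp hZ)).mul (hφ.comp hZ)
  refine hM.mono' hm.aestronglyMeasurable ?_
  filter_upwards [hae] with ω hω
  rw [Real.norm_eq_abs, abs_mul]
  exact (mul_le_mul_of_nonneg_left (hφw _) (abs_nonneg _)).trans
    (hω _ (by simpa using mul_nonneg hr.le (weight_pos _).le))

/-- Dominated convergence: by continuity of g' the modulus with radius r / (n + 1) tends to zero
pointwise, and it is at most 2M. -/
theorem LocallyDominated.exists_modulus_integrable (h : LocallyDominated P G Z)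
    (hG : IsContrast G) (hZ : Measurable Z) (k : Fin p) {ε : ℝ} (hε : 0 < ε) :
    ∃ η > 0, Integrable (fun ω => modulus (deriv (deriv G)) k η (Z ω)) P ∧
      ∫ ω, modulus (deriv (deriv G)) k η (Z ω) ∂P < ε := by
  obtain ⟨r, hr, M, hM, hae⟩ := h.exists_integrable_bound k
  have hc := hG.continuous_deriv_deriv
  have hm : ∀ η, AEStronglyMeasurable (fun ω => modulus (deriv (deriv G)) k η (Z ω)) P := fun η =>
    ((continuous_modulus hc k η).measurable.comp hZ).aestronglyMeasurable
  have hb : ∀ n : ℕ, ∀ᵐ ω ∂P, ‖modulus (deriv (deriv G)) k (r / (n + 1)) (Z ω)‖ ≤ 2 * M ω := by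
    intro n
    filter_upwards [hae] with ω hω
    have hw := weight_pos (Z ω)
    rw [Real.norm_eq_abs, abs_of_nonneg (modulus_nonneg _ _ _ _)]
    refine modulus_le k (by positivity) _ fun y hy => ?_
    have hrn : r / ((n : ℝ) + 1) ≤ r := div_le_self hr.le (by linarith [n.cast_nonneg (α := ℝ)])
    have h1 := hω y (hy.trans (by gcongr))
    have h2 := hω (Z ω k) (by simpa using mul_nonneg hr.le hw.le)
    have h3 := abs_sub (deriv (deriv G) y) (deriv (deriv G) (Z ω k))
    nlinarith [sq_nonneg (weight (Z ω))]
  have ht : Tendsto (fun n : ℕ => ∫ ω, modulus (deriv (deriv G)) k (r / (n + 1)) (Z ω) ∂P) atTop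
      (𝓝 (∫ _, (0 : ℝ) ∂P)) :=
    tendsto_integral_of_dominated_convergence _ (fun n => hm _) (hM.const_mul 2) hb
      (Eventually.of_forall fun ω => tendsto_modulus hc k (Z ω) hr)
  rw [integral_zero] at ht
  obtain ⟨n, hn⟩ := (ht.eventually_lt_const hε).exists
  exact ⟨r / (n + 1), by positivity, (hM.const_mul 2).mono' (hm _) (hb n), hn⟩

end Taylor

/-! ### Expansion of the empirical means around the true directions -/

section Expansion

variable {Ω : Type*} [MeasurableSpace Ω] {P : Measure Ω} {p : ℕ}
  {z : ℕ → Ω → Fin p → ℝ} {G : ℝ → ℝ} {U : ℕ × Ω → Fin p → ℝ} {t : ℕ × Ω → ℝ} {k : Fin p}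

theorem tendsto_sum_abs_add_abs
    (hU : ∀ m, Tendsto (fun q => U q m - (1 : Matrix (Fin p) (Fin p) ℝ) k m) (probFilter P) (𝓝 0))
    (ht : Tendsto t (probFilter P) (𝓝 0)) :
    Tendsto (fun q => ∑ m, |U q m - (1 : Matrix (Fin p) (Fin p) ℝ) k m| + |t q|) (probFilter P)
      (𝓝 0) := by
  simpa using (tendsto_finsetSum Finset.univ fun m _ => (hU m).abs).add ht.abs

variable [IsProbabilityMeasure P]

/-- Once the total displacement d of direction and shift is below η, the remainder of each summand
is at most d times the modulus with radius η. The empirical mean of that modulus is below c with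
probability tending to one, by the law of large numbers. The bound is uniform in the direction, so U
and t may depend on the sample. -/
theorem isLittleO_empMean_taylor (hG : IsContrast G) (hz : IsIIDSample P z)
    (hdom : LocallyDominated P G (z 0))
    (hU : ∀ m, Tendsto (fun q => U q m - (1 : Matrix (Fin p) (Fin p) ℝ) k m) (probFilter P) (𝓝 0))
    (ht : Tendsto t (probFilter P) (𝓝 0)) {φ : (Fin p → ℝ) → ℝ} (hφw : ∀ v, |φ v| ≤ weight v) :
    (fun q => empMean z (fun v => deriv G (U q ⬝ᵥ v + t q) * φ v) q
        - empMean z (fun v => deriv G (v k) * φ v) q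
        - (∑ m, (U q m - (1 : Matrix (Fin p) (Fin p) ℝ) k m)
              * empMean z (fun v => deriv (deriv G) (v k) * (v m * φ v)) q
            + t q * empMean z (fun v => deriv (deriv G) (v k) * φ v) q))
      =o[probFilter P] fun q => ∑ m, |U q m - (1 : Matrix (Fin p) (Fin p) ℝ) k m| + |t q| := by
  refine isLittleO_iff.2 fun c hc => ?_
  have hgc := hG.continuous_deriv_deriv
  obtain ⟨η, hη, hmi, hmc⟩ := hdom.exists_modulus_integrable hG (hz.measurable 0) k hc
  have hL := (hz.tendsto_empMean (continuous_modulus hgc k η).measurable hmi).eventually_lt_const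
    hmc
  filter_upwards [hL, (tendsto_sum_abs_add_abs hU ht).eventually_lt_const hη] with q hq1 hq2
  set d := ∑ m, |U q m - (1 : Matrix (Fin p) (Fin p) ℝ) k m| + |t q| with hd
  have hd0 : 0 ≤ d := add_nonneg (Finset.sum_nonneg fun _ _ => abs_nonneg _) (abs_nonneg _)
  have hrw : empMean z (fun v => deriv G (U q ⬝ᵥ v + t q) * φ v) q
        - empMean z (fun v => deriv G (v k) * φ v) q
        - (∑ m, (U q m - (1 : Matrix (Fin p) (Fin p) ℝ) k m)
              * empMean z (fun v => deriv (deriv G) (v k) * (v m * φ v)) q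
            + t q * empMean z (fun v => deriv (deriv G) (v k) * φ v) q)
      = empMean z (fun v => (deriv G (U q ⬝ᵥ v + t q) - deriv G (v k)
          - deriv (deriv G) (v k) * (U q ⬝ᵥ v + t q - v k)) * φ v) q := by
    simp only [← empMean_const_mul, ← empMean_sum, ← empMean_sub, ← empMean_add]
    congr 1
    ext v
    have h1 : U q ⬝ᵥ v = v k + ∑ m, (U q m - (1 : Matrix (Fin p) (Fin p) ℝ) k m) * v m := by
      simp [dotProduct, sub_mul, Matrix.one_apply]
    have h2 : ∑ m, (U q m - (1 : Matrix (Fin p) (Fin p) ℝ) k m)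
        * (deriv (deriv G) (v k) * (v m * φ v))
        = deriv (deriv G) (v k) * φ v
          * ∑ m, (U q m - (1 : Matrix (Fin p) (Fin p) ℝ) k m) * v m := by
      rw [Finset.mul_sum]
      exact Finset.sum_congr rfl fun m _ => by ring
    rw [h2, h1]
    ring
  rw [hrw, Real.norm_eq_abs, Real.norm_eq_abs, abs_of_nonneg hd0]
  calc |empMean z (fun v => (deriv G (U q ⬝ᵥ v + t q) - deriv G (v k)
          - deriv (deriv G) (v k) * (U q ⬝ᵥ v + t q - v k)) * φ v) q|
      ≤ empMean z (fun v => d * modulus (deriv (deriv G)) k η v) q := by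
        refine abs_empMean_le fun i _ => ?_
        generalize z i q.2 = v
        have hw := weight_pos v
        have hh := abs_dotProduct_add_sub_le (U q) v (t q) k
        rw [← hd] at hh
        have hT := abs_sub_sub_le_of_abs_deriv_sub_le hG.differentiable_deriv
          (x := v k) (y := U q ⬝ᵥ v + t q) (C := modulus (deriv (deriv G)) k η v / weight v ^ 2)
          (fun ξ hξ => by
            rw [le_div_iff₀ (by positivity)]
            exact abs_sub_mul_le_modulus hgc k hη v (hξ.trans (hh.trans (by gcongr))))
        have hm := modulus_nonneg (deriv (deriv G)) k η v
        rw [abs_mul]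
        -- One factor `weight v` comes from the displacement of the argument and one from φ;
        -- together they cancel the square built into the modulus.
        calc _ ≤ (modulus (deriv (deriv G)) k η v / weight v ^ 2 * (d * weight v)) * weight v :=
              mul_le_mul (hT.trans (by gcongr)) (hφw v) (abs_nonneg _) (by positivity)
          _ = d * modulus (deriv (deriv G)) k η v := by field_simp
    _ = d * empMean z (modulus (deriv (deriv G)) k η) q := empMean_const_mul _ _ _
    _ ≤ c * d := by rw [mul_comm]; gcongr

theorem tendsto_empMean_contrast (hG : IsContrast G) (hz : IsIIDSample P z)
    (hmom : HasMoments P G (z 0)) (hdom : LocallyDominated P G (z 0))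
    (hint : ∀ m, Integrable (fun ω => deriv G (z 0 ω k) * z 0 ω m) P)
    (hU : ∀ m, Tendsto (fun q => U q m - (1 : Matrix (Fin p) (Fin p) ℝ) k m) (probFilter P) (𝓝 0))
    (ht : Tendsto t (probFilter P) (𝓝 0)) :
    Tendsto (fun q => empMean z (fun v => G (U q ⬝ᵥ v + t q)) q) (probFilter P)
      (𝓝 (nu P G fun ω => z 0 ω k)) := by
  have hgc := hG.continuous_deriv_deriv
  have hg := hG.continuous_deriv
  obtain ⟨η, hη, hmi, -⟩ := hdom.exists_modulus_integrable hG (hz.measurable 0) k one_pos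
  set B : (Fin p → ℝ) → ℝ := fun v => |deriv G (v k)| * weight v
    + (|deriv (deriv G) (v k)| * weight v ^ 2 + modulus (deriv (deriv G)) k η v) with hB
  have hmw := continuous_modulus hgc k η
  have hw := continuous_weight (p := p)
  have hBm : Measurable B := Continuous.measurable (by fun_prop)
  have hBi : Integrable (fun ω => B (z 0 ω)) P := by
    refine Integrable.add ?_ (Integrable.add ?_ hmi)
    · have h1 : Integrable (fun ω => |deriv G (z 0 ω k)| + ∑ m, |deriv G (z 0 ω k) * z 0 ω m|) P :=
        ((hmom.nonlin k).integrable one_le_two).abs.add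
          (integrable_finsetSum _ fun m _ => (hint m).abs)
      refine h1.congr (Eventually.of_forall fun ω => ?_)
      simp [weight, mul_add, Finset.mul_sum, abs_mul]
    · have := (hdom.integrable_deriv_mul hG (hz.measurable 0) k
        (φ := fun v => weight v ^ 2) (by fun_prop) (fun v => by simp)).abs
      refine this.congr (Eventually.of_forall fun ω => ?_)
      simp [abs_mul]
  have h0 := hz.tendsto_empMean (hG.contDiff.continuous.measurable.comp (measurable_pi_apply k))
    (hmom.contrast k)
  have hd := tendsto_sum_abs_add_abs hU ht
  have hprod := hd.mul (hz.tendsto_empMean hBm hBi)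
  rw [zero_mul] at hprod
  have hdiff : Tendsto (fun q => empMean z (fun v => G (U q ⬝ᵥ v + t q)) q
      - empMean z (fun v => G (v k)) q) (probFilter P) (𝓝 0) := by
    refine squeeze_zero_norm' ?_ hprod
    filter_upwards [hd.eventually_lt_const hη, hd.eventually_lt_const one_pos] with q hq hq1
    set d := ∑ m, |U q m - (1 : Matrix (Fin p) (Fin p) ℝ) k m| + |t q| with hd
    have hd0 : 0 ≤ d := add_nonneg (Finset.sum_nonneg fun _ _ => abs_nonneg _) (abs_nonneg _)
    rw [Real.norm_eq_abs, ← empMean_sub, ← empMean_const_mul]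
    refine abs_empMean_le fun i _ => ?_
    generalize z i q.2 = v
    have hw := weight_pos v
    have hh := abs_dotProduct_add_sub_le (U q) v (t q) k
    rw [← hd] at hh
    set D := (|deriv (deriv G) (v k)| * weight v ^ 2 + modulus (deriv (deriv G)) k η v)
      / weight v ^ 2 with hD
    have hm := modulus_nonneg (deriv (deriv G)) k η v
    have hD0 : 0 ≤ D := by positivity
    have hDle : ∀ ξ, |ξ - v k| ≤ d * weight v → |deriv (deriv G) ξ| ≤ D := fun ξ hξ => by
      rw [hD, le_div_iff₀ (by positivity)]
      have h1 := abs_sub_mul_le_modulus hgc k hη v (hξ.trans (by gcongr))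
      have h2 := abs_sub_abs_le_abs_sub (deriv (deriv G) ξ) (deriv (deriv G) (v k))
      nlinarith [sq_nonneg (weight v)]
    have hT := abs_sub_sub_le_of_abs_deriv_sub_le hG.differentiable
      (x := v k) (y := U q ⬝ᵥ v + t q) (C := D * (d * weight v)) (fun ξ hξ => by
        have := Convex.norm_image_sub_le_of_norm_deriv_le (f := deriv G) (C := D)
          (s := Metric.closedBall (v k) (d * weight v)) (x := v k) (y := ξ)
          (fun x _ => hG.differentiable_deriv x)
          (fun x hx => hDle x (by simpa [Real.dist_eq] using hx)) (convex_closedBall _ _)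
          (by simp; positivity) (by simpa [Real.dist_eq] using hξ.trans hh)
        rw [Real.norm_eq_abs, Real.norm_eq_abs] at this
        exact this.trans (by gcongr; exact hξ.trans hh))
    set y := U q ⬝ᵥ v + t q
    have hDw : D * weight v ^ 2 = |deriv (deriv G) (v k)| * weight v ^ 2
        + modulus (deriv (deriv G)) k η v := div_mul_cancel₀ _ (by positivity)
    calc |G y - G (v k)|
        = |(G y - G (v k) - deriv G (v k) * (y - v k)) + deriv G (v k) * (y - v k)| := by ring_nf
      _ ≤ D * (d * weight v) * |y - v k| + |deriv G (v k)| * |y - v k| := by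
        rw [← abs_mul (deriv G (v k))]
        exact (abs_add_le _ _).trans (by gcongr)
      _ ≤ D * (d * weight v) * (1 * weight v) + |deriv G (v k)| * (d * weight v) := by
        gcongr
        exact hh.trans (by gcongr)
      _ = d * (|deriv G (v k)| * weight v + D * weight v ^ 2) := by ring
      _ = d * B v := by rw [hDw]
  simpa [Function.comp_def, nu] using hdiff.add h0

end Expansion

/-! ### The statistics as empirical means -/

section Statistics

variable {Ω : Type*} {p : ℕ} {z x : ℕ → Ω → Fin p → ℝ} {loc : Fin p → ℝ} {G : ℝ → ℝ}

/-- The empirical mean of the latent vectors. -/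
noncomputable def latentMean (z : ℕ → Ω → Fin p → ℝ) (q : ℕ × Ω) : Fin p → ℝ :=
  fun k => empMean z (fun v => v k) q

/-- The location cancels. For n = 0 it would not: both means are then zero by convention. -/
theorem sub_sampleMean (hx : ∀ i ω, x i ω = loc + z i ω) {q : ℕ × Ω} (hq : 0 < (q.1 : ℝ)) (i : ℕ) :
    x i q.2 - sampleMean q.1 (fun i => x i q.2) = z i q.2 - latentMean z q := by
  ext k
  have : (q.1 : ℝ) ≠ 0 := hq.ne'
  simp only [sampleMean, hx, latentMean, empMean, Finset.sum_add_distrib, Finset.sum_const,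
    Finset.card_range, Pi.sub_apply, Pi.add_apply, Pi.smul_apply, Finset.sum_apply, smul_eq_mul,
    nsmul_eq_mul, Pi.natCast_apply, Pi.mul_apply]
  field_simp
  ring

theorem sampleCov_apply (hx : ∀ i ω, x i ω = loc + z i ω) {q : ℕ × Ω} (hq : 0 < (q.1 : ℝ))
    (k m : Fin p) :
    sampleCov q.1 (fun i => x i q.2) k m
      = empMean z (fun v => v k * v m) q - latentMean z q k * latentMean z q m := by
  have h : sampleCov q.1 (fun i => x i q.2) k m
      = empMean z (fun v => (v k - latentMean z q k) * (v m - latentMean z q m)) q := by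
    simp only [sampleCov, sub_sampleMean hx hq, empMean]
    simp [Matrix.smul_apply, Matrix.sum_apply, Matrix.vecMulVec_apply]
  have h2 : (fun v : Fin p → ℝ => (v k - latentMean z q k) * (v m - latentMean z q m))
      = fun v => v k * v m - latentMean z q m * v k - latentMean z q k * v m
        + latentMean z q k * latentMean z q m := by
    ext v
    ring
  rw [h, h2, empMean_add, empMean_sub, empMean_sub, empMean_const_mul, empMean_const_mul,
    empMean_const hq]
  simp only [latentMean]
  ring

theorem dotProduct_sub_latentMean (γ v : Fin p → ℝ) (q : ℕ × Ω) :
    γ ⬝ᵥ (v - latentMean z q) = γ ⬝ᵥ v + -(γ ⬝ᵥ latentMean z q) := by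
  rw [dotProduct_sub, sub_eq_add_neg]

theorem sampleG_eq (hx : ∀ i ω, x i ω = loc + z i ω) {q : ℕ × Ω} (hq : 0 < (q.1 : ℝ))
    (γ : Fin p → ℝ) :
    sampleG G q.1 (fun i => x i q.2) γ
      = empMean z (fun v => G (γ ⬝ᵥ v + -(γ ⬝ᵥ latentMean z q))) q := by
  simp only [sampleG, sub_sampleMean hx hq, dotProduct_sub_latentMean, empMean]

/-- The factor 1 gives both means the shape of the Taylor lemma, with φ a coordinate and φ = 1. -/
theorem sampleT_apply (hx : ∀ i ω, x i ω = loc + z i ω) {q : ℕ × Ω} (hq : 0 < (q.1 : ℝ))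
    (γ : Fin p → ℝ) (m : Fin p) :
    sampleT G q.1 (fun i => x i q.2) γ m
      = empMean z (fun v => deriv G (γ ⬝ᵥ v + -(γ ⬝ᵥ latentMean z q)) * v m) q
        - latentMean z q m
          * empMean z (fun v => deriv G (γ ⬝ᵥ v + -(γ ⬝ᵥ latentMean z q)) * 1) q := by
  rw [← empMean_const_mul, ← empMean_sub]
  simp only [sampleT, sub_sampleMean hx hq, dotProduct_sub_latentMean, empMean, Pi.smul_apply,
    Finset.sum_apply, Pi.sub_apply, smul_eq_mul]
  congr 1
  exact Finset.sum_congr rfl fun i _ => by ring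

end Statistics

/-! ### Moments of products of independent components -/

section Moments

variable {Ω : Type*} [MeasurableSpace Ω] {P : Measure Ω}

/-- `X` is integrable with mean `a`. -/
def HasMean (P : Measure Ω) (X : Ω → ℝ) (a : ℝ) : Prop := Integrable X P ∧ ∫ ω, X ω ∂P = a

theorem HasMean.add {X Y : Ω → ℝ} {a b : ℝ} (hX : HasMean P X a) (hY : HasMean P Y b) :
    HasMean P (fun ω => X ω + Y ω) (a + b) :=
  ⟨hX.1.add hY.1, by rw [integral_add hX.1 hY.1, hX.2, hY.2]⟩

theorem HasMean.sub {X Y : Ω → ℝ} {a b : ℝ} (hX : HasMean P X a) (hY : HasMean P Y b) :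
    HasMean P (fun ω => X ω - Y ω) (a - b) :=
  ⟨hX.1.sub hY.1, by rw [integral_sub hX.1 hY.1, hX.2, hY.2]⟩

theorem HasMean.const_mul {X : Ω → ℝ} {a : ℝ} (hX : HasMean P X a) (c : ℝ) :
    HasMean P (fun ω => c * X ω) (c * a) :=
  ⟨hX.1.const_mul c, by rw [integral_const_mul, hX.2]⟩

theorem HasMean.congr {X Y : Ω → ℝ} {a b : ℝ} (hX : HasMean P X a) (h : ∀ ω, Y ω = X ω)
    (hab : a = b) : HasMean P Y b := by
  obtain rfl : Y = X := funext h
  exact hab ▸ hX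

variable {p : ℕ} {Z : Ω → Fin p → ℝ} {G : ℝ → ℝ} {j k l m : Fin p}

theorem IsSource.indepFun_comp (hs : IsSource P Z) (hjl : j ≠ l) {f h : ℝ → ℝ}
    (hf : Measurable f) (hh : Measurable h) :
    IndepFun (fun ω => f (Z ω j)) (fun ω => h (Z ω l)) P :=
  (hs.indep.indepFun hjl).comp hf hh

theorem IsSource.integral_pair_mul (hs : IsSource P Z) (hZ : Measurable Z) (hjl : j ≠ l)
    (hml : m ≠ l) {f : ℝ × ℝ → ℝ} (hf : Measurable f) :
    ∫ ω, f (Z ω j, Z ω m) * Z ω l ∂P = 0 := by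
  have hm : ∀ k, Measurable fun ω => Z ω k := fun k => (measurable_pi_apply k).comp hZ
  have h := ((hs.indep.indepFun_prodMk hm j m l hjl hml).comp hf
    measurable_id).integral_fun_mul_eq_mul_integral
    (hf.comp ((hm j).prodMk (hm m))).aestronglyMeasurable (hm l).aestronglyMeasurable
  simpa [hs.mean_zero l] using h

/-- The part of `g` that is orthogonal to the affine functions in the law of the component `k`. -/
noncomputable def residual (P : Measure Ω) (G : ℝ → ℝ) (Z : Ω → Fin p → ℝ) (k : Fin p) (y : ℝ) : ℝ :=
  deriv G y - (∫ ω, deriv G (Z ω k) ∂P) - lam P G (fun ω => Z ω k) * y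

theorem IsContrast.measurable_residual (hG : IsContrast G) (k : Fin p) :
    Measurable (residual P G Z k) := by
  have := hG.continuous_deriv
  exact Continuous.measurable (by unfold residual; fun_prop)

/-- The form of the influence functions of the off-diagonal entries of the estimates. -/
noncomputable def influence (P : Measure Ω) (G : ℝ → ℝ) (Z : Ω → Fin p → ℝ) (j l : Fin p) (a b c : ℝ)
    (v : Fin p → ℝ) : ℝ :=
  a * (residual P G Z j (v j) * v l) + b * (residual P G Z l (v l) * v j) + c * (v j * v l)

theorem IsContrast.measurable_influence (hG : IsContrast G) (a b c : ℝ) :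
    Measurable (influence P G Z j l a b c) := by
  have h1 := hG.measurable_residual (P := P) (Z := Z) j
  have h2 := hG.measurable_residual (P := P) (Z := Z) l
  unfold influence
  fun_prop

theorem IsSource.memLp (hs : IsSource P Z) (hZ : Measurable Z) (k : Fin p) :
    MemLp (fun ω => Z ω k) 2 P := by
  refine (memLp_two_iff_integrable_sq
    (Measurable.aestronglyMeasurable (by fun_prop))).2 ?_
  -- A non-integrable square would have integral 0 by convention, against the second moment 1.
  by_contra h
  have := hs.second_moment k
  rw [integral_undef h] at this
  exact zero_ne_one this

theorem IsSource.integral_mul (hs : IsSource P Z) (hZ : Measurable Z) (hjl : j ≠ l) {f h : ℝ → ℝ}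
    (hf : Measurable f) (hh : Measurable h) :
    ∫ ω, f (Z ω j) * h (Z ω l) ∂P = (∫ ω, f (Z ω j) ∂P) * ∫ ω, h (Z ω l) ∂P :=
  (hs.indepFun_comp hjl hf hh).integral_fun_mul_eq_mul_integral
    (hf.comp ((measurable_pi_apply j).comp hZ)).aestronglyMeasurable
    (hh.comp ((measurable_pi_apply l).comp hZ)).aestronglyMeasurable

theorem IsSource.integrable_mul (hs : IsSource P Z) (hjl : j ≠ l) {f h : ℝ → ℝ}
    (hf : Measurable f) (hh : Measurable h) (hfi : Integrable (fun ω => f (Z ω j)) P)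
    (hhi : Integrable (fun ω => h (Z ω l)) P) :
    Integrable (fun ω => f (Z ω j) * h (Z ω l)) P :=
  (hs.indepFun_comp hjl hf hh).integrable_mul hfi hhi

theorem IsSource.memLp_mul (hs : IsSource P Z) (hZ : Measurable Z) (hjl : j ≠ l) {f h : ℝ → ℝ}
    (hf : Measurable f) (hh : Measurable h) (hfi : MemLp (fun ω => f (Z ω j)) 2 P)
    (hhi : MemLp (fun ω => h (Z ω l)) 2 P) :
    MemLp (fun ω => f (Z ω j) * h (Z ω l)) 2 P := by
  refine (memLp_two_iff_integrable_sq
    (Measurable.aestronglyMeasurable (by fun_prop))).2 ?_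
  simpa only [mul_pow] using hs.integrable_mul (f := fun y => f y ^ 2) (h := fun y => h y ^ 2) hjl
    (hf.pow_const 2) (hh.pow_const 2) hfi.integrable_sq hhi.integrable_sq

theorem IsSource.integral_mul_self (hs : IsSource P Z) (hZ : Measurable Z) (k m : Fin p) :
    ∫ ω, Z ω k * Z ω m ∂P = (1 : Matrix (Fin p) (Fin p) ℝ) k m := by
  by_cases h : k = m
  · subst h
    simpa [sq] using hs.second_moment k
  · rw [hs.integral_mul (f := fun y => y) (h := fun y => y) hZ h measurable_id' measurable_id']
    simp [hs.mean_zero, h]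

theorem HasMoments.memLp_mul_self (hmom : HasMoments P G Z) (hs : IsSource P Z)
    (hZ : Measurable Z) (k m : Fin p) : MemLp (fun ω => Z ω k * Z ω m) 2 P := by
  by_cases h : k = m
  · subst h
    have hm : Measurable fun ω => Z ω k := (measurable_pi_apply k).comp hZ
    refine (memLp_two_iff_integrable_sq (Measurable.aestronglyMeasurable (by fun_prop))).2 ?_
    refine (hmom.fourth k).congr (Eventually.of_forall fun ω => ?_)
    ring
  · exact hs.memLp_mul (f := fun y => y) (h := fun y => y) hZ h measurable_id' measurable_id' (hs.memLp hZ k)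
      (hs.memLp hZ m)

theorem HasMoments.integrable_nonlin_mul (hmom : HasMoments P G Z) (hs : IsSource P Z)
    (hZ : Measurable Z) (k m : Fin p) : Integrable (fun ω => deriv G (Z ω k) * Z ω m) P :=
  (hmom.nonlin k).integrable_mul (hs.memLp hZ m)

theorem IsSource.integral_nonlin_mul (hs : IsSource P Z) (hG : IsContrast G) (hZ : Measurable Z)
    (k m : Fin p) :
    ∫ ω, deriv G (Z ω k) * Z ω m ∂P
      = lam P G (fun ω => Z ω k) * (1 : Matrix (Fin p) (Fin p) ℝ) k m := by
  by_cases h : k = m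
  · subst h
    simp [lam]
  · rw [hs.integral_mul (h := fun y => y) hZ h hG.continuous_deriv.measurable measurable_id']
    simp [hs.mean_zero, h]

theorem IsSource.integral_deriv_nonlin_mul (hs : IsSource P Z) (hG : IsContrast G)
    (hZ : Measurable Z) (hjl : j ≠ l) :
    ∫ ω, deriv (deriv G) (Z ω j) * Z ω l ∂P = 0 := by
  rw [hs.integral_mul (h := fun y => y) hZ hjl hG.continuous_deriv_deriv.measurable measurable_id']
  simp [hs.mean_zero]

/-- For m ≠ l the component l is independent of the pair (j, m) and centred, even when m = j. Hence
the entry l of T(γ_j) feels, to first order, no deviation of the row j other than its entry l. -/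
theorem IsSource.integral_deriv_nonlin_mul_mul (hs : IsSource P Z) (hG : IsContrast G)
    (hZ : Measurable Z) (hjl : j ≠ l) (m : Fin p) :
    ∫ ω, deriv (deriv G) (Z ω j) * (Z ω m * Z ω l) ∂P
      = del P G (fun ω => Z ω j) * (1 : Matrix (Fin p) (Fin p) ℝ) m l := by
  have hg := hG.continuous_deriv_deriv.measurable
  by_cases h : m = l
  · subst h
    rw [hs.integral_mul (h := fun y => y * y) hZ hjl hg (by fun_prop)]
    have := hs.second_moment m
    simp only [sq] at this
    simp [this, del]
  · have := hs.integral_pair_mul hZ hjl h (f := fun y => deriv (deriv G) y.1 * y.2)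
      ((hg.comp measurable_fst).mul measurable_snd)
    simpa [h, mul_assoc] using this

variable [IsProbabilityMeasure P]

theorem IsSource.integrable (hs : IsSource P Z) (hZ : Measurable Z) (k : Fin p) :
    Integrable (fun ω => Z ω k) P :=
  (hs.memLp hZ k).integrable one_le_two

theorem HasMoments.memLp_nonlin_sub (hmom : HasMoments P G Z) (c : ℝ) (k : Fin p) :
    MemLp (fun ω => deriv G (Z ω k) - c) 2 P :=
  (hmom.nonlin k).sub (memLp_const c)

theorem HasMoments.memLp_residual (hmom : HasMoments P G Z) (hs : IsSource P Z)
    (hZ : Measurable Z) (k : Fin p) : MemLp (fun ω => residual P G Z k (Z ω k)) 2 P :=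
  (hmom.memLp_nonlin_sub _ k).sub ((hs.memLp hZ k).const_mul _)

theorem HasMoments.integral_residual_mul (hmom : HasMoments P G Z) (hs : IsSource P Z)
    (hZ : Measurable Z) (k : Fin p) : ∫ ω, residual P G Z k (Z ω k) * Z ω k ∂P = 0 := by
  have h1 : HasMean P (fun ω => deriv G (Z ω k) * Z ω k) (lam P G fun ω => Z ω k) :=
    ⟨hmom.integrable_nonlin_mul hs hZ k k, rfl⟩
  have h2 : HasMean P (fun ω => Z ω k) 0 := ⟨hs.integrable hZ k, hs.mean_zero k⟩
  have h3 : HasMean P (fun ω => Z ω k ^ 2) 1 := ⟨(hs.memLp hZ k).integrable_sq, hs.second_moment k⟩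
  exact (((h1.sub (h2.const_mul (∫ ω, deriv G (Z ω k) ∂P))).sub
    (h3.const_mul (lam P G fun ω => Z ω k))).congr
    (fun ω => by simp only [residual]; ring) (by ring)).2

theorem HasMoments.integral_residual_sq (hmom : HasMoments P G Z) (hs : IsSource P Z)
    (hZ : Measurable Z) (k : Fin p) :
    ∫ ω, residual P G Z k (Z ω k) ^ 2 ∂P
      = sigmaSq P G (fun ω => Z ω k) - lam P G (fun ω => Z ω k) ^ 2 := by
  set c := ∫ ω, deriv G (Z ω k) ∂P with hc
  set a := lam P G (fun ω => Z ω k) with ha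
  have h1 : HasMean P (fun ω => (deriv G (Z ω k) - c) ^ 2) (sigmaSq P G fun ω => Z ω k) :=
    ⟨(hmom.memLp_nonlin_sub c k).integrable_sq,
      (variance_eq_integral (hmom.nonlin k).aestronglyMeasurable.aemeasurable).symm⟩
  have h2 : HasMean P (fun ω => deriv G (Z ω k) * Z ω k) a :=
    ⟨hmom.integrable_nonlin_mul hs hZ k k, rfl⟩
  have h3 : HasMean P (fun ω => Z ω k) 0 := ⟨hs.integrable hZ k, hs.mean_zero k⟩
  have h4 : HasMean P (fun ω => Z ω k ^ 2) 1 := ⟨(hs.memLp hZ k).integrable_sq, hs.second_moment k⟩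
  exact ((((h1.sub (h2.const_mul (2 * a))).add (h3.const_mul (2 * a * c))).add
    (h4.const_mul (a ^ 2))).congr
    (fun ω => by simp only [residual, ← hc, ← ha]; ring) (by ring)).2

theorem HasMoments.memLp_residual_mul (hmom : HasMoments P G Z) (hG : IsContrast G)
    (hs : IsSource P Z) (hZ : Measurable Z) (hjl : j ≠ l) :
    MemLp (fun ω => residual P G Z j (Z ω j) * Z ω l) 2 P :=
  hs.memLp_mul (h := fun y => y) hZ hjl (hG.measurable_residual j) measurable_id'
    (hmom.memLp_residual hs hZ j) (hs.memLp hZ l)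

theorem HasMoments.memLp_influence (hmom : HasMoments P G Z) (hG : IsContrast G)
    (hs : IsSource P Z) (hZ : Measurable Z) (hjl : j ≠ l) (a b c : ℝ) :
    MemLp (fun ω => influence P G Z j l a b c (Z ω)) 2 P :=
  (((hmom.memLp_residual_mul hG hs hZ hjl).const_mul a).add
    ((hmom.memLp_residual_mul hG hs hZ hjl.symm).const_mul b)).add
    ((hmom.memLp_mul_self hs hZ j l).const_mul c)

theorem HasMoments.integral_influence (hmom : HasMoments P G Z) (hG : IsContrast G)
    (hs : IsSource P Z) (hZ : Measurable Z) (hjl : j ≠ l) (a b c : ℝ) :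
    ∫ ω, influence P G Z j l a b c (Z ω) ∂P = 0 := by
  have h1 := (hmom.memLp_residual_mul hG hs hZ hjl).integrable one_le_two
  have h2 := (hmom.memLp_residual_mul hG hs hZ hjl.symm).integrable one_le_two
  have h3 := (hmom.memLp_mul_self hs hZ j l).integrable one_le_two
  have e1 := hs.integral_mul (h := fun y => y) hZ hjl (hG.measurable_residual (P := P) (Z := Z) j)
    measurable_id'
  have e2 := hs.integral_mul (h := fun y => y) hZ hjl.symm (hG.measurable_residual (P := P) (Z := Z) l)
    measurable_id'
  have e3 : ∫ ω, Z ω j * Z ω l ∂P = 0 := by simp [hs.integral_mul_self hZ, hjl]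
  simp only [hs.mean_zero, mul_zero] at e1 e2
  exact (((HasMean.const_mul ⟨h1, e1⟩ a).add (HasMean.const_mul ⟨h2, e2⟩ b)).add
    (HasMean.const_mul ⟨h3, e3⟩ c) |>.congr (fun ω => rfl) (by ring)).2

/-- All three cross terms vanish: by independence each contains a factor E[u(Y) Y], and the residual
u is orthogonal to Y. -/
theorem HasMoments.integral_influence_sq (hmom : HasMoments P G Z) (hG : IsContrast G)
    (hs : IsSource P Z) (hZ : Measurable Z) (hjl : j ≠ l) (a b c : ℝ) :
    ∫ ω, influence P G Z j l a b c (Z ω) ^ 2 ∂P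
      = a ^ 2 * (sigmaSq P G (fun ω => Z ω j) - lam P G (fun ω => Z ω j) ^ 2)
        + b ^ 2 * (sigmaSq P G (fun ω => Z ω l) - lam P G (fun ω => Z ω l) ^ 2) + c ^ 2 := by
  set u := residual P G Z j with hu
  set w := residual P G Z l with hw
  have hum : Measurable u := hG.measurable_residual j
  have hwm : Measurable w := hG.measurable_residual l
  have huL : MemLp (fun ω => u (Z ω j)) 2 P := hmom.memLp_residual hs hZ j
  have hwL : MemLp (fun ω => w (Z ω l)) 2 P := hmom.memLp_residual hs hZ l
  have hjL := hs.memLp hZ j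
  have hlL := hs.memLp hZ l
  have i1 := hs.integrable_mul (f := fun y => u y ^ 2) (h := fun y => y ^ 2) hjl (by fun_prop)
    (by fun_prop) huL.integrable_sq hlL.integrable_sq
  have i2 := hs.integrable_mul (f := fun y => y ^ 2) (h := fun y => w y ^ 2) hjl (by fun_prop)
    (by fun_prop) hjL.integrable_sq hwL.integrable_sq
  have i3 := hs.integrable_mul (f := fun y => y ^ 2) (h := fun y => y ^ 2) hjl (by fun_prop)
    (by fun_prop) hjL.integrable_sq hlL.integrable_sq
  have i4 := hs.integrable_mul (f := fun y => u y * y) (h := fun y => w y * y) hjl (by fun_prop)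
    (by fun_prop) (huL.integrable_mul hjL) (hwL.integrable_mul hlL)
  have i5 := hs.integrable_mul (f := fun y => u y * y) (h := fun y => y ^ 2) hjl (by fun_prop)
    (by fun_prop) (huL.integrable_mul hjL) hlL.integrable_sq
  have i6 := hs.integrable_mul (f := fun y => y ^ 2) (h := fun y => w y * y) hjl (by fun_prop)
    (by fun_prop) hjL.integrable_sq (hwL.integrable_mul hlL)
  have e1 := hs.integral_mul (f := fun y => u y ^ 2) (h := fun y => y ^ 2) hZ hjl (by fun_prop)
    (by fun_prop)
  have e2 := hs.integral_mul (f := fun y => y ^ 2) (h := fun y => w y ^ 2) hZ hjl (by fun_prop)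
    (by fun_prop)
  have e3 := hs.integral_mul (f := fun y => y ^ 2) (h := fun y => y ^ 2) hZ hjl (by fun_prop)
    (by fun_prop)
  have e4 := hs.integral_mul (f := fun y => u y * y) (h := fun y => w y * y) hZ hjl (by fun_prop)
    (by fun_prop)
  have e5 := hs.integral_mul (f := fun y => u y * y) (h := fun y => y ^ 2) hZ hjl (by fun_prop)
    (by fun_prop)
  have e6 := hs.integral_mul (f := fun y => y ^ 2) (h := fun y => w y * y) hZ hjl (by fun_prop)
    (by fun_prop)
  simp only [hu, hw, hmom.integral_residual_mul hs hZ, hmom.integral_residual_sq hs hZ,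
    hs.second_moment, mul_zero, mul_one, one_mul] at e1 e2 e3 e4 e5 e6
  rw [← hu] at e1 e4 e5
  rw [← hw] at e2 e4 e6
  have j1 : HasMean P _ _ := HasMean.const_mul ⟨i1, e1⟩ (a ^ 2)
  have j2 : HasMean P _ _ := HasMean.const_mul ⟨i2, e2⟩ (b ^ 2)
  have j3 : HasMean P _ _ := HasMean.const_mul ⟨i3, e3⟩ (c ^ 2)
  have j4 : HasMean P _ _ := HasMean.const_mul ⟨i4, e4⟩ (2 * a * b)
  have j5 : HasMean P _ _ := HasMean.const_mul ⟨i5, e5⟩ (2 * a * c)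
  have j6 : HasMean P _ _ := HasMean.const_mul ⟨i6, e6⟩ (2 * b * c)
  exact ((((((j1.add j2).add j3).add j4).add j5).add j6).congr
    (fun ω => by simp only [influence, ← hu, ← hw]; ring) (by ring)).2

end Moments

/-! ### First order solution of the estimating equations -/

section FirstOrder

variable {A : Type*} {L : Filter A} {p : ℕ}

/-- A finite family that equals `O(ρ)` up to an error negligible against `ρ` and the family itself
is `O(ρ)`. -/
theorem isBigO_sum_of_isLittleO_self {ι : Type*} [Fintype ι] {ρ : A → ℝ} {f g : ι → A → ℝ}
    (hg : ∀ i, g i =O[L] ρ)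
    (h : ∀ i, (fun q => f i q - g i q) =o[L] fun q => |ρ q| + ∑ i, |f i q|) :
    (fun q => ∑ i, |f i q|) =O[L] ρ := by
  have h1 : (fun q => ∑ i, |g i q|) =O[L] ρ := IsBigO.fun_sum fun i _ => (hg i).abs_left
  have h2 : (fun q => ∑ i, |f i q - g i q|) =o[L] fun q => |ρ q| + ∑ i, |f i q| :=
    IsLittleO.fun_sum fun i _ => (h i).abs_left
  obtain ⟨C, hC⟩ := h1.bound
  refine IsBigO.of_bound (2 * C + 1) ?_
  -- Absorption: F ≤ C |ρ| + (|ρ| + F) / 2 gives F ≤ (2C + 1) |ρ|.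
  filter_upwards [hC, h2.bound one_half_pos] with q hq1 hq2
  have n1 : 0 ≤ ∑ i, |f i q| := Finset.sum_nonneg fun _ _ => abs_nonneg _
  have n2 : 0 ≤ ∑ i, |g i q| := Finset.sum_nonneg fun _ _ => abs_nonneg _
  have n3 : 0 ≤ ∑ i, |f i q - g i q| := Finset.sum_nonneg fun _ _ => abs_nonneg _
  have hle : ∑ i, |f i q| ≤ ∑ i, |g i q| + ∑ i, |f i q - g i q| := by
    rw [← Finset.sum_add_distrib]
    refine Finset.sum_le_sum fun i _ => ?_
    calc |f i q| = |g i q + (f i q - g i q)| := by ring_nf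
      _ ≤ _ := abs_add_le _ _
  simp only [Real.norm_eq_abs, abs_of_nonneg n1, abs_of_nonneg n2, abs_of_nonneg n3,
    abs_of_nonneg (add_nonneg (abs_nonneg (ρ q)) n1)] at hq1 hq2 ⊢
  linarith

/-- The deviation of the entry `(j, m)` from the identity. -/
def dev (Γ : A → Matrix (Fin p) (Fin p) ℝ) (j m : Fin p) (q : A) : ℝ :=
  Γ q j m - (1 : Matrix (Fin p) (Fin p) ℝ) j m

/-- The size of the deviation of the row `j`, on top of the base rate `ρ`. -/
def rowScale (ρ : A → ℝ) (Γ : A → Matrix (Fin p) (Fin p) ℝ) (j : Fin p) (q : A) : ℝ :=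
  |ρ q| + ∑ m, |dev Γ j m q|

/-- The first order expansions, along `L` and with base rate `ρ`, of the covariance matrix `S` and
of the vectors `T j` at the rows of `Γ`. -/
structure IsFirstOrder (L : Filter A) (ρ : A → ℝ) (Γ S T : A → Matrix (Fin p) (Fin p) ℝ)
    (C Q : Fin p → Fin p → A → ℝ) (lm δ : Fin p → ℝ) : Prop where
  dev_tendsto : ∀ j m, Tendsto (dev Γ j m) L (𝓝 0)
  rate_tendsto : Tendsto ρ L (𝓝 0)
  cov_symm : ∀ j m, C j m = C m j
  cov_isBigO : ∀ j m, C j m =O[L] ρ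
  cov : ∀ j m, (fun q => dev S j m q - C j m q) =o[L] ρ
  score_isBigO : ∀ j m, j ≠ m → Q j m =O[L] ρ
  score : ∀ j m, j ≠ m → (fun q => T q j m - Q j m q - δ j * dev Γ j m q) =o[L] rowScale ρ Γ j
  score_tendsto : ∀ j m, Tendsto (fun q => T q j m) L
    (𝓝 (lm j * (1 : Matrix (Fin p) (Fin p) ℝ) j m))
  whitening : ∀ᶠ q in L, Γ q * S q * (Γ q)ᵀ = 1

variable {ρ : A → ℝ} {Γ S T : A → Matrix (Fin p) (Fin p) ℝ} {C Q : Fin p → Fin p → A → ℝ}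
  {lm δ : Fin p → ℝ}

theorem isBigO_rowScale (j : Fin p) : ρ =O[L] rowScale ρ Γ j :=
  IsBigO.of_bound 1 (Eventually.of_forall fun q => by
    have : 0 ≤ ∑ m, |dev Γ j m q| := Finset.sum_nonneg fun _ _ => abs_nonneg _
    rw [one_mul, Real.norm_eq_abs, Real.norm_eq_abs]
    exact (le_add_of_nonneg_right this).trans (le_abs_self _))

theorem dev_isBigO_rowScale (j m : Fin p) : dev Γ j m =O[L] rowScale ρ Γ j :=
  IsBigO.of_bound 1 (Eventually.of_forall fun q => by
    have : |dev Γ j m q| ≤ ∑ m, |dev Γ j m q| :=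
      Finset.single_le_sum (f := fun m => |dev Γ j m q|) (fun _ _ => abs_nonneg _)
        (Finset.mem_univ m)
    rw [one_mul, Real.norm_eq_abs, Real.norm_eq_abs]
    exact (this.trans (le_add_of_nonneg_left (abs_nonneg _))).trans (le_abs_self _))

theorem isLittleO_mul_of_tendsto_zero {f g r : A → ℝ} (hf : Tendsto f L (𝓝 0)) (hg : g =O[L] r) :
    (fun q => f q * g q) =o[L] r := by
  simpa using ((isLittleO_one_iff ℝ).2 hf).mul_isBigO hg

namespace IsFirstOrder

theorem cov_dev_isBigO (h : IsFirstOrder L ρ Γ S T C Q lm δ) (j m : Fin p) : dev S j m =O[L] ρ :=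
  ((h.cov j m).isBigO.add (h.cov_isBigO j m)).congr_left fun q => by ring

theorem cov_row (h : IsFirstOrder L ρ Γ S T C Q lm δ) (j l : Fin p) :
    (fun q => (S q *ᵥ Γ q j) l - (1 : Matrix (Fin p) (Fin p) ℝ) j l - dev Γ j l q - C j l q)
      =o[L] rowScale ρ Γ j := by
  have h1 : (fun q => ∑ m, dev S l m q * dev Γ j m q) =o[L] rowScale ρ Γ j :=
    IsLittleO.fun_sum fun m _ => isLittleO_mul_of_tendsto_zero
      ((h.cov_dev_isBigO l m).trans_tendsto h.rate_tendsto) (dev_isBigO_rowScale j m)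
  refine (((h.cov l j).trans_isBigO (isBigO_rowScale j)).add h1).congr_left fun q => ?_
  rw [h.cov_symm l j]
  simp only [dev, sub_mul, mul_sub, Finset.sum_sub_distrib, Matrix.mulVec, dotProduct,
    Matrix.one_apply, mul_ite, ite_mul, mul_one, one_mul, mul_zero, zero_mul, Finset.sum_ite_eq,
    Finset.mem_univ, if_true]
  ring

theorem cov_row_isBigO (h : IsFirstOrder L ρ Γ S T C Q lm δ) (j l : Fin p) :
    (fun q => (S q *ᵥ Γ q j) l - (1 : Matrix (Fin p) (Fin p) ℝ) j l) =O[L] rowScale ρ Γ j :=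
  (((h.cov_row j l).isBigO.add (dev_isBigO_rowScale j l)).add
    ((h.cov_isBigO j l).trans (isBigO_rowScale j))).congr_left fun q => by ring

/-- Linearised constraint γ_lᵀ S γ_j = 1_{lj}. The quadratic error pairs the deviation of row l,
which tends to zero by consistency, with S γ_j - e_j, which is O of the scale of row j. No rate for
row l is needed, and this asymmetry makes the sequential induction possible. For l = j it determines
the diagonal entry. -/
theorem dev_add_dev (h : IsFirstOrder L ρ Γ S T C Q lm δ) (j l : Fin p) :
    (fun q => dev Γ l j q + dev Γ j l q + C j l q) =o[L] rowScale ρ Γ j := by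
  have h1 : (fun q => ∑ m, dev Γ l m q
      * ((S q *ᵥ Γ q j) m - (1 : Matrix (Fin p) (Fin p) ℝ) j m)) =o[L] rowScale ρ Γ j :=
    IsLittleO.fun_sum fun m _ => isLittleO_mul_of_tendsto_zero (h.dev_tendsto l m) (h.cov_row_isBigO j m)
  refine (h1.neg_left.sub (h.cov_row j l)).congr' ?_ EventuallyEq.rfl
  filter_upwards [h.whitening] with q hq
  have h2 : Γ q l ⬝ᵥ (S q *ᵥ Γ q j) = (1 : Matrix (Fin p) (Fin p) ℝ) l j := by
    rw [← hq, Matrix.mul_assoc]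
    simp [Matrix.mul_apply, dotProduct, Matrix.mulVec]
  have h3 : ∑ m, dev Γ l m q * ((S q *ᵥ Γ q j) m - (1 : Matrix (Fin p) (Fin p) ℝ) j m)
      = Γ q l ⬝ᵥ (S q *ᵥ Γ q j) - (S q *ᵥ Γ q j) l - Γ q l j
        + (1 : Matrix (Fin p) (Fin p) ℝ) l j := by
    generalize S q *ᵥ Γ q j = w
    simp only [dev, sub_mul, mul_sub, Finset.sum_sub_distrib, dotProduct,
      Matrix.one_apply, mul_ite, ite_mul, mul_one, one_mul, mul_zero, zero_mul, Finset.sum_ite_eq,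
      Finset.mem_univ, if_true]
    ring
  have h4 : (1 : Matrix (Fin p) (Fin p) ℝ) l j = (1 : Matrix (Fin p) (Fin p) ℝ) j l := by
    simp [Matrix.one_apply, eq_comm]
  rw [h3, h2]
  simp only [dev, h4]
  ring

theorem score_dot_eq (q : A) (j l : Fin p) :
    Γ q l ⬝ᵥ T q j = T q j l + lm j * dev Γ l j q
      + ∑ m, dev Γ l m q * (T q j m - lm j * (1 : Matrix (Fin p) (Fin p) ℝ) j m) := by
  generalize T q j = w
  simp only [dev, sub_mul, mul_sub, Finset.sum_sub_distrib, dotProduct,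
    Matrix.one_apply, mul_ite, ite_mul, mul_one, one_mul, mul_zero, zero_mul, Finset.sum_ite_eq,
    Finset.mem_univ, if_true]
  ring

theorem score_sub_tendsto (h : IsFirstOrder L ρ Γ S T C Q lm δ) (j m : Fin p) :
    Tendsto (fun q => T q j m - lm j * (1 : Matrix (Fin p) (Fin p) ℝ) j m) L (𝓝 0) := by
  simpa using (h.score_tendsto j m).sub_const (lm j * (1 : Matrix (Fin p) (Fin p) ℝ) j m)

/-- T(γ_j) tends to λ_j e_j, so the deviation of row l contributes only λ_j times its entry j. -/
theorem score_dot (h : IsFirstOrder L ρ Γ S T C Q lm δ) {j l : Fin p} (hjl : j ≠ l) {r : A → ℝ}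
    (hj : rowScale ρ Γ j =O[L] r) (hl : rowScale ρ Γ l =O[L] r) :
    (fun q => Γ q l ⬝ᵥ T q j - (Q j l q + δ j * dev Γ j l q + lm j * dev Γ l j q)) =o[L] r := by
  have h1 : (fun q => ∑ m, dev Γ l m q
      * (T q j m - lm j * (1 : Matrix (Fin p) (Fin p) ℝ) j m)) =o[L] r :=
    IsLittleO.fun_sum fun m _ => (isLittleO_mul_of_tendsto_zero (h.score_sub_tendsto j m)
      ((dev_isBigO_rowScale l m).trans hl)).congr_left fun q => mul_comm _ _
  refine (((h.score j l hjl).trans_isBigO hj).add h1).congr_left fun q => ?_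
  rw [score_dot_eq (lm := lm)]
  ring

theorem score_dot_tendsto (h : IsFirstOrder L ρ Γ S T C Q lm δ) (j l : Fin p) :
    Tendsto (fun q => Γ q l ⬝ᵥ T q j) L (𝓝 (lm j * (1 : Matrix (Fin p) (Fin p) ℝ) j l)) := by
  have h1 : Tendsto (fun q => ∑ m, dev Γ l m q
      * (T q j m - lm j * (1 : Matrix (Fin p) (Fin p) ℝ) j m)) L (𝓝 0) := by
    simpa using tendsto_finsetSum Finset.univ fun m _ =>
      (h.dev_tendsto l m).mul (h.score_sub_tendsto j m)
  have h2 := ((h.score_tendsto j l).add ((h.dev_tendsto l j).const_mul (lm j))).add h1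
  simp only [mul_zero, add_zero] at h2
  exact h2.congr fun q => (score_dot_eq q j l).symm

/-! #### Sequential extraction -/

/-- One row of the deflation-based equations, when the preceding rows have rate `ρ`. -/
theorem deflation_row (h : IsFirstOrder L ρ Γ S T C Q lm δ) {j l : Fin p} (hjl : j < l)
    (heq : ∀ᶠ q in L, T q j
      = (S q * ∑ m ∈ Finset.Iic j, Matrix.vecMulVec (Γ q m) (Γ q m)) *ᵥ T q j)
    (hprev : ∀ m < j, rowScale ρ Γ m =O[L] ρ) :
    (fun q => (lm j - δ j) * dev Γ j l q - (Q j l q - lm j * C j l q)) =o[L] rowScale ρ Γ j := by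
  have hone : ∀ m < l, (1 : Matrix (Fin p) (Fin p) ℝ) m l = 0 := fun m hm =>
    Matrix.one_apply_ne hm.ne
  have hu : ∀ m < l, (fun q => (S q *ᵥ Γ q m) l) =O[L] rowScale ρ Γ m := fun m hm => by
    simpa [hone m hm] using h.cov_row_isBigO m l
  -- An earlier row m contributes a product of γ_mᵀT(γ_j), which tends to λ_j 1_{jm} = 0, and (S
  -- γ_m)_l, which is O(ρ) by the rate of row m.
  have h1 : (fun q => ∑ m ∈ Finset.Iio j, (Γ q m ⬝ᵥ T q j) * (S q *ᵥ Γ q m) l)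
      =o[L] rowScale ρ Γ j := by
    refine IsLittleO.fun_sum fun m hm => ?_
    have hm' := Finset.mem_Iio.1 hm
    refine (isLittleO_mul_of_tendsto_zero ?_ ((hu m (hm'.trans hjl)).trans (hprev m hm'))).trans_isBigO
      (isBigO_rowScale j)
    simpa [Matrix.one_apply_ne hm'.ne'] using h.score_dot_tendsto j m
  have h2 : (fun q => (Γ q j ⬝ᵥ T q j - lm j) * (S q *ᵥ Γ q j) l) =o[L] rowScale ρ Γ j := by
    refine isLittleO_mul_of_tendsto_zero ?_ (hu j hjl)
    simpa using (h.score_dot_tendsto j j).sub_const (lm j)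
  have h3 := (h.cov_row j l).const_mul_left (lm j)
  refine ((((h.score j l hjl.ne).sub h1).sub h2).sub h3).congr' ?_ EventuallyEq.rfl
  filter_upwards [heq] with q hq
  have h4 : T q j l = ∑ m ∈ Finset.Iio j, (Γ q m ⬝ᵥ T q j) * (S q *ᵥ Γ q m) l
      + (Γ q j ⬝ᵥ T q j) * (S q *ᵥ Γ q j) l := by
    have h5 : T q j l = ∑ m ∈ Finset.Iic j, (Γ q m ⬝ᵥ T q j) * (S q *ᵥ Γ q m) l := by
      conv_lhs => rw [hq]
      rw [← Matrix.mulVec_mulVec, Matrix.sum_mulVec, Matrix.mulVec_sum, Finset.sum_apply]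
      refine Finset.sum_congr rfl fun m _ => ?_
      rw [Matrix.vecMulVec_mulVec]
      simp [Matrix.mulVec_smul]
    rw [h5, ← Finset.Iio_insert, Finset.sum_insert (by simp), add_comm]
  rw [hone j hjl, h4]
  ring

/-- Induction along the order of extraction. Entries before the diagonal come from earlier rows
through the constraint, the diagonal entry from the constraint alone, later entries from the row's
own equation divided by λ_j - δ_j. Later rows never enter, hence the condition only for k ≤ j. -/
theorem deflation_rowScale (h : IsFirstOrder L ρ Γ S T C Q lm δ)
    (heq : ∀ᶠ q in L, ∀ j, T q j
      = (S q * ∑ m ∈ Finset.Iic j, Matrix.vecMulVec (Γ q m) (Γ q m)) *ᵥ T q j)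
    (j : Fin p) (hj : ∀ k ≤ j, lm k ≠ δ k) : rowScale ρ Γ j =O[L] ρ := by
  induction j using WellFoundedLT.induction with
  | ind j ih =>
    have hprev : ∀ m < j, rowScale ρ Γ m =O[L] ρ := fun m hm =>
      ih m hm fun k hk => hj k (hk.trans hm.le)
    have key : ∀ m, ∃ g : A → ℝ, g =O[L] ρ ∧
        (fun q => dev Γ j m q - g q) =o[L] fun q => |ρ q| + ∑ m, |dev Γ j m q| := by
      intro m
      rcases lt_trichotomy m j with hm | rfl | hm
      · refine ⟨fun q => -C m j q - dev Γ m j q, (h.cov_isBigO m j).neg_left.sub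
          ((dev_isBigO_rowScale m j).trans (hprev m hm)), ?_⟩
        exact (((h.dev_add_dev m j).trans_isBigO (hprev m hm)).trans_isBigO
          (isBigO_rowScale j)).congr_left fun q => by ring
      · refine ⟨fun q => (-1 / 2) * C m m q, (h.cov_isBigO m m).const_mul_left _, ?_⟩
        exact ((h.dev_add_dev m m).const_mul_left (1 / 2)).congr_left fun q => by ring
      · refine ⟨fun q => (lm j - δ j)⁻¹ * (Q j m q - lm j * C j m q),
          ((h.score_isBigO j m hm.ne).sub ((h.cov_isBigO j m).const_mul_left _)).const_mul_left _,
          ?_⟩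
        refine ((h.deflation_row hm (heq.mono fun q hq => hq j) hprev).const_mul_left
          (lm j - δ j)⁻¹).congr_left fun q => ?_
        have := sub_ne_zero.2 (hj j le_rfl)
        field_simp
    choose g hg hgo using key
    exact (isBigO_refl ρ L).abs_left.add (isBigO_sum_of_isLittleO_self hg hgo)

theorem deflation (h : IsFirstOrder L ρ Γ S T C Q lm δ)
    (heq : ∀ᶠ q in L, ∀ j, T q j
      = (S q * ∑ m ∈ Finset.Iic j, Matrix.vecMulVec (Γ q m) (Γ q m)) *ᵥ T q j)
    {j l : Fin p} (hjl : j < l) (hj : ∀ k ≤ j, lm k ≠ δ k) :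
    (fun q => dev Γ j l q - (lm j - δ j)⁻¹ * (Q j l q - lm j * C j l q)) =o[L] ρ ∧
      (fun q => dev Γ l j q - (-(lm j - δ j)⁻¹ * (Q j l q - lm j * C j l q) - C j l q))
        =o[L] ρ := by
  have hr := h.deflation_rowScale heq j hj
  have h1 := (h.deflation_row hjl (heq.mono fun q hq => hq j) fun m hm =>
    h.deflation_rowScale heq m fun k hk => hj k (hk.trans hm.le)).trans_isBigO hr
  have hne := sub_ne_zero.2 (hj j le_rfl)
  have h2 : (fun q => dev Γ j l q - (lm j - δ j)⁻¹ * (Q j l q - lm j * C j l q)) =o[L] ρ := by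
    refine (h1.const_mul_left (lm j - δ j)⁻¹).congr_left fun q => ?_
    field_simp
  refine ⟨h2, (((h.dev_add_dev j l).trans_isBigO hr).sub h2).congr_left fun q => by ring⟩

/-! #### Simultaneous extraction -/

/-- The constraint eliminates the entry (l, j) from the linearised equation. The scale r is left
free because the result serves twice: with all deviations included, to obtain the rate, and then
with ρ. The weights need only be bounded, as long as a_k (λ_k - δ_k) converges. -/
theorem symmetric_pair (h : IsFirstOrder L ρ Γ S T C Q lm δ) {a : Fin p → A → ℝ} {β : Fin p → ℝ}
    (ha : ∀ j, a j =O[L] fun _ => (1 : ℝ))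
    (hβ : ∀ j, Tendsto (fun q => a j q * (lm j - δ j)) L (𝓝 (β j)))
    (heq : ∀ᶠ q in L, ∀ j l, a j q * (Γ q l ⬝ᵥ T q j) = a l q * (Γ q j ⬝ᵥ T q l))
    {j l : Fin p} (hjl : j ≠ l) {r : A → ℝ}
    (hj : rowScale ρ Γ j =O[L] r) (hl : rowScale ρ Γ l =O[L] r) :
    (fun q => (β j + β l) * dev Γ j l q
      - (a j q * (Q j l q - lm j * C j l q) - a l q * (Q l j q - δ l * C j l q))) =o[L] r := by
  have hW := (h.dev_add_dev j l).trans_isBigO hj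
  have hD := (dev_isBigO_rowScale (L := L) (ρ := ρ) (Γ := Γ) j l).trans hj
  have hβ0 : ∀ k, Tendsto (fun q => a k q * (lm k - δ k) - β k) L (𝓝 0) := fun k => by
    simpa using (hβ k).sub_const (β k)
  have ho : ∀ (k : Fin p) {f : A → ℝ}, f =o[L] r → (fun q => a k q * f q) =o[L] r :=
    fun k f hf => by simpa using (ha k).mul_isLittleO hf
  have h1 := ho j ((hW.const_mul_left (lm j)).add (h.score_dot hjl hj hl))
  have h2 := ho l ((hW.const_mul_left (δ l)).add (h.score_dot hjl.symm hl hj))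
  have h3 := isLittleO_mul_of_tendsto_zero (hβ0 j) hD
  have h4 := isLittleO_mul_of_tendsto_zero (hβ0 l) hD
  refine (((h1.sub h2).sub h3).sub h4).congr' ?_ EventuallyEq.rfl
  filter_upwards [heq] with q hq
  linear_combination hq j l

/-- Each equation couples two rows, so no row can be treated first: the absorption runs over all p²
entries, and β_j + β_l ≠ 0 is needed for every pair. -/
theorem symmetric_rowScale (h : IsFirstOrder L ρ Γ S T C Q lm δ) {a : Fin p → A → ℝ}
    {β : Fin p → ℝ} (ha : ∀ j, a j =O[L] fun _ => (1 : ℝ))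
    (hβ : ∀ j, Tendsto (fun q => a j q * (lm j - δ j)) L (𝓝 (β j)))
    (hne : ∀ j l, j ≠ l → β j + β l ≠ 0)
    (heq : ∀ᶠ q in L, ∀ j l, a j q * (Γ q l ⬝ᵥ T q j) = a l q * (Γ q j ⬝ᵥ T q l)) (j : Fin p) :
    rowScale ρ Γ j =O[L] ρ := by
  set r : A → ℝ := fun q => |ρ q| + ∑ i : Fin p × Fin p, |dev Γ i.1 i.2 q| with hr
  have hle : ∀ q j, ∑ m, |dev Γ j m q| ≤ ∑ i : Fin p × Fin p, |dev Γ i.1 i.2 q| := fun q j => by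
    rw [Fintype.sum_prod_type]
    exact Finset.single_le_sum (f := fun j => ∑ m, |dev Γ j m q|)
      (fun _ _ => Finset.sum_nonneg fun _ _ => abs_nonneg _) (Finset.mem_univ j)
  have hrow : ∀ j, rowScale ρ Γ j =O[L] r := fun j =>
    IsBigO.of_bound 1 (Eventually.of_forall fun q => by
      have h1 : 0 ≤ rowScale ρ Γ j q :=
        add_nonneg (abs_nonneg _) (Finset.sum_nonneg fun _ _ => abs_nonneg _)
      rw [one_mul, Real.norm_eq_abs, Real.norm_eq_abs, abs_of_nonneg h1]
      exact (add_le_add_right (hle q j) |ρ q|).trans (le_abs_self _))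
  have hO : ∀ (k : Fin p) {f : A → ℝ}, f =O[L] ρ → (fun q => a k q * f q) =O[L] ρ :=
    fun k f hf => by simpa using (ha k).mul hf
  have key : ∀ i : Fin p × Fin p, ∃ g : A → ℝ, g =O[L] ρ ∧
      (fun q => dev Γ i.1 i.2 q - g q) =o[L] r := by
    rintro ⟨j, l⟩
    by_cases hjl : j = l
    · subst hjl
      refine ⟨fun q => (-1 / 2) * C j j q, (h.cov_isBigO j j).const_mul_left _, ?_⟩
      exact (((h.dev_add_dev j j).trans_isBigO (hrow j)).const_mul_left (1 / 2)).congr_left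
        fun q => by ring
    · refine ⟨fun q => (β j + β l)⁻¹ * (a j q * (Q j l q - lm j * C j l q)
          - a l q * (Q l j q - δ l * C j l q)), IsBigO.const_mul_left ?_ _, ?_⟩
      · exact (hO j ((h.score_isBigO j l hjl).sub ((h.cov_isBigO j l).const_mul_left _))).sub
          (hO l ((h.score_isBigO l j (Ne.symm hjl)).sub ((h.cov_isBigO j l).const_mul_left _)))
      · refine ((h.symmetric_pair ha hβ heq hjl (hrow j) (hrow l)).const_mul_left
          (β j + β l)⁻¹).congr_left fun q => ?_
        have := hne j l hjl
        field_simp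
  choose g hg hgo using key
  exact (hrow j).trans ((isBigO_refl ρ L).abs_left.add (isBigO_sum_of_isLittleO_self hg hgo))

theorem symmetric (h : IsFirstOrder L ρ Γ S T C Q lm δ) {a : Fin p → A → ℝ} {β : Fin p → ℝ}
    (ha : ∀ j, a j =O[L] fun _ => (1 : ℝ))
    (hβ : ∀ j, Tendsto (fun q => a j q * (lm j - δ j)) L (𝓝 (β j)))
    (hne : ∀ j l, j ≠ l → β j + β l ≠ 0)
    (heq : ∀ᶠ q in L, ∀ j l, a j q * (Γ q l ⬝ᵥ T q j) = a l q * (Γ q j ⬝ᵥ T q l))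
    {j l : Fin p} (hjl : j ≠ l) {b c : ℝ} (hb : Tendsto (a j) L (𝓝 b))
    (hc : Tendsto (a l) L (𝓝 c)) :
    (fun q => dev Γ j l q - (β j + β l)⁻¹ * (b * (Q j l q - lm j * C j l q)
      - c * (Q l j q - δ l * C j l q))) =o[L] ρ := by
  have hrow := h.symmetric_rowScale ha hβ hne heq
  have h1 := h.symmetric_pair ha hβ heq hjl (hrow j) (hrow l)
  have hb0 : Tendsto (fun q => a j q - b) L (𝓝 0) := by simpa using hb.sub_const b
  have hc0 : Tendsto (fun q => a l q - c) L (𝓝 0) := by simpa using hc.sub_const c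
  -- The weights may be replaced by their limits, since the terms they multiply are O(ρ).
  have h2 := isLittleO_mul_of_tendsto_zero hb0
    ((h.score_isBigO j l hjl).sub ((h.cov_isBigO j l).const_mul_left (lm j)))
  have h3 := isLittleO_mul_of_tendsto_zero hc0
    ((h.score_isBigO l j hjl.symm).sub ((h.cov_isBigO j l).const_mul_left (δ l)))
  refine (((h1.add h2).sub h3).const_mul_left (β j + β l)⁻¹).congr_left fun q => ?_
  have := hne j l hjl
  field_simp
  ring

end IsFirstOrder

end FirstOrder

/-! ### The statistics satisfy the first order expansions -/

section SampleExpansion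

variable {Ω : Type*} [MeasurableSpace Ω] {P : Measure Ω} {p : ℕ}
  {z x : ℕ → Ω → Fin p → ℝ} {loc : Fin p → ℝ} {G : ℝ → ℝ}

theorem weight_le_sq (v : Fin p → ℝ) : weight v ≤ weight v ^ 2 :=
  le_self_pow₀ (one_le_weight v) two_ne_zero

theorem isBigO_dotProduct_latentMean {ρ : ℕ × Ω → ℝ} {Γ : ℕ × Ω → Matrix (Fin p) (Fin p) ℝ}
    (hρ : ∀ k, (fun q => latentMean z q k) =O[probFilter P] ρ)
    (hΓ : ∀ j m, Tendsto (dev Γ j m) (probFilter P) (𝓝 0)) (j : Fin p) :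
    (fun q => -(Γ q j ⬝ᵥ latentMean z q)) =O[probFilter P] ρ := by
  refine IsBigO.neg_left (IsBigO.fun_sum fun m _ => ?_)
  have h1 : Tendsto (fun q => Γ q j m) (probFilter P)
      (𝓝 ((1 : Matrix (Fin p) (Fin p) ℝ) j m)) := by
    simpa [dev] using (hΓ j m).add_const ((1 : Matrix (Fin p) (Fin p) ℝ) j m)
  simpa using (h1.isBigO_one ℝ).mul (hρ m)

variable [IsProbabilityMeasure P]

theorem IsIIDSample.tendsto_empMean_deriv_mul (hz : IsIIDSample P z) (hG : IsContrast G)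
    (hdom : LocallyDominated P G (z 0)) (k : Fin p) {φ : (Fin p → ℝ) → ℝ} (hφ : Measurable φ)
    (hφw : ∀ v, |φ v| ≤ weight v ^ 2) :
    Tendsto (empMean z fun v => deriv (deriv G) (v k) * φ v) (probFilter P)
      (𝓝 (∫ ω, deriv (deriv G) (z 0 ω k) * φ (z 0 ω) ∂P)) :=
  hz.tendsto_empMean ((hG.continuous_deriv_deriv.measurable.comp (measurable_pi_apply k)).mul hφ)
    (hdom.integrable_deriv_mul hG (hz.measurable 0) k hφ hφw)

theorem abs_mul_le_weight_sq (m : Fin p) {φ : (Fin p → ℝ) → ℝ} (hφw : ∀ v, |φ v| ≤ weight v)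
    (v : Fin p → ℝ) : |v m * φ v| ≤ weight v ^ 2 := by
  rw [abs_mul, sq]
  exact mul_le_mul (abs_le_weight v m) (hφw v) (abs_nonneg _) (weight_pos v).le

theorem tendsto_empMean_nonlin (hG : IsContrast G) (hz : IsIIDSample P z)
    (hdom : LocallyDominated P G (z 0)) {U : ℕ × Ω → Fin p → ℝ} {t : ℕ × Ω → ℝ} {k : Fin p}
    (hU : ∀ m, Tendsto (fun q => U q m - (1 : Matrix (Fin p) (Fin p) ℝ) k m) (probFilter P) (𝓝 0))
    (ht : Tendsto t (probFilter P) (𝓝 0)) {φ : (Fin p → ℝ) → ℝ} (hφ : Measurable φ)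
    (hφw : ∀ v, |φ v| ≤ weight v)
    (hi : Integrable (fun ω => deriv G (z 0 ω k) * φ (z 0 ω)) P) :
    Tendsto (fun q => empMean z (fun v => deriv G (U q ⬝ᵥ v + t q) * φ v) q) (probFilter P)
      (𝓝 (∫ ω, deriv G (z 0 ω k) * φ (z 0 ω) ∂P)) := by
  have h1 := (isLittleO_empMean_taylor hG hz hdom hU ht hφw).trans_tendsto
    (tendsto_sum_abs_add_abs hU ht)
  have hg := hG.continuous_deriv.measurable
  have h2 := hz.tendsto_empMean (ψ := fun v => deriv G (v k) * φ v) (by fun_prop) hi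
  have h3 := tendsto_finsetSum Finset.univ fun m _ => (hU m).mul
    (hz.tendsto_empMean_deriv_mul hG hdom k (φ := fun v => v m * φ v)
      ((measurable_pi_apply m).mul hφ) (abs_mul_le_weight_sq m hφw))
  have h4 := ht.mul (hz.tendsto_empMean_deriv_mul hG hdom k hφ
    fun v => (hφw v).trans (weight_le_sq v))
  have h5 := (h1.add (h3.add h4)).add h2
  simp only [zero_mul, Finset.sum_const_zero, zero_add] at h5
  refine h5.congr fun q => ?_
  ring

/-- The centred second moments of the latent vectors. -/
noncomputable def covTerm (z : ℕ → Ω → Fin p → ℝ) (j m : Fin p) : ℕ × Ω → ℝ :=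
  empMean z fun v => v j * v m - (1 : Matrix (Fin p) (Fin p) ℝ) j m

/-- The leading term of the statistic `T` in the direction `e j`. -/
noncomputable def scoreTerm (P : Measure Ω) (G : ℝ → ℝ) (z : ℕ → Ω → Fin p → ℝ) (j m : Fin p) :
    ℕ × Ω → ℝ :=
  empMean z fun v => (deriv G (v j) - ∫ ω, deriv G (z 0 ω j) ∂P) * v m

theorem exists_rate_sample (hG : IsContrast G) (hz : IsIIDSample P z) (hs : IsSource P (z 0))
    (hmom : HasMoments P G (z 0)) :
    ∃ ρ : ℕ × Ω → ℝ, (∀ k, (fun q => latentMean z q k) =O[probFilter P] ρ) ∧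
      (∀ j m, covTerm z j m =O[probFilter P] ρ) ∧
      (∀ j m, j ≠ m → scoreTerm P G z j m =O[probFilter P] ρ) ∧ Tendsto ρ (probFilter P) (𝓝 0) ∧
      ∀ h : ℕ × Ω → ℝ, h =o[probFilter P] ρ →
        Tendsto (fun q => √(q.1 : ℝ) * h q) (probFilter P) (𝓝 0) := by
  have hZ := hz.measurable 0
  have hg := hG.continuous_deriv.measurable
  have h1 : ∀ k, Tight P fun q => √(q.1 : ℝ) * latentMean z q k := fun k =>
    hz.tight_empMean (measurable_pi_apply k) (hs.memLp hZ k) (hs.mean_zero k)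
  have h2 : ∀ i : Fin p × Fin p, Tight P fun q => √(q.1 : ℝ) * covTerm z i.1 i.2 q := fun i => by
    have hL := hmom.memLp_mul_self hs hZ i.1 i.2
    refine hz.tight_empMean (by fun_prop) (hL.sub (memLp_const _)) ?_
    rw [integral_sub (hL.integrable one_le_two) (integrable_const _), hs.integral_mul_self hZ]
    simp
  -- Off-diagonal terms only: the diagonal ones have mean λ instead of zero.
  have h3 : ∀ i : {i : Fin p × Fin p // i.1 ≠ i.2},
      Tight P fun q => √(q.1 : ℝ) * scoreTerm P G z i.1.1 i.1.2 q := fun i => by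
    refine hz.tight_empMean (by fun_prop)
      (hs.memLp_mul (f := fun y => deriv G y - ∫ ω, deriv G (z 0 ω i.1.1) ∂P) (h := fun y => y) hZ
        i.2 (by fun_prop) measurable_id' (hmom.memLp_nonlin_sub _ _) (hs.memLp hZ _)) ?_
    rw [hs.integral_mul (f := fun y => deriv G y - ∫ ω, deriv G (z 0 ω i.1.1) ∂P)
      (h := fun y => y) hZ i.2 (by fun_prop) measurable_id', hs.mean_zero, mul_zero]
  obtain ⟨ρ, hρ, hρ0, hρh⟩ := exists_rate (P := P)
    (ι := Fin p ⊕ (Fin p × Fin p) ⊕ {i : Fin p × Fin p // i.1 ≠ i.2})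
    (f := Sum.elim (fun k q => latentMean z q k)
      (Sum.elim (fun i => covTerm z i.1 i.2) fun i => scoreTerm P G z i.1.1 i.1.2))
    (by
      rintro (k | i | i)
      exacts [h1 k, h2 i, h3 i])
  exact ⟨ρ, fun k => hρ (.inl k), fun j m => hρ (.inr (.inl (j, m))),
    fun j m hjm => hρ (.inr (.inr ⟨(j, m), hjm⟩)), hρ0, hρh⟩

theorem tendsto_sampleG (hG : IsContrast G) (hx : ∀ i ω, x i ω = loc + z i ω)
    (hz : IsIIDSample P z) (hs : IsSource P (z 0)) (hmom : HasMoments P G (z 0))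
    (hdom : LocallyDominated P G (z 0)) {Γ : ℕ × Ω → Matrix (Fin p) (Fin p) ℝ}
    (hΓ : ∀ j m, Tendsto (dev Γ j m) (probFilter P) (𝓝 0)) (j : Fin p) :
    Tendsto (fun q => sampleG G q.1 (fun i => x i q.2) (Γ q j)) (probFilter P)
      (𝓝 (nu P G fun ω => z 0 ω j)) := by
  obtain ⟨ρ, hρ, -, -, hρ0, -⟩ := exists_rate_sample hG hz hs hmom
  refine (tendsto_empMean_contrast hG hz hmom hdom
    (fun m => hmom.integrable_nonlin_mul hs (hz.measurable 0) j m) (hΓ j)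
    ((isBigO_dotProduct_latentMean hρ hΓ j).trans_tendsto hρ0)).congr' ?_
  filter_upwards [eventually_pos_probFilter] with q hq
  rw [sampleG_eq hx hq]

/-- In the score expansion the empirical coefficients are replaced by their limits: E[g'(z_j) z_m
z_l] = δ_j 1_{ml}, and E[g'(z_j) z_l] = 0, which removes the random shift. Centring by the sample
mean leaves -E[g(z_j)] times the mean of z_l; this is the centring of g inside `scoreTerm`. -/
theorem exists_isFirstOrder (hG : IsContrast G) (hx : ∀ i ω, x i ω = loc + z i ω)
    (hz : IsIIDSample P z) (hs : IsSource P (z 0)) (hmom : HasMoments P G (z 0))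
    (hdom : LocallyDominated P G (z 0)) {Γ : ℕ × Ω → Matrix (Fin p) (Fin p) ℝ}
    (hΓ : ∀ j m, Tendsto (dev Γ j m) (probFilter P) (𝓝 0))
    (hw : ∀ᶠ q in probFilter P, IsWhitening q.1 (fun i => x i q.2) (Γ q)) :
    ∃ ρ : ℕ × Ω → ℝ, IsFirstOrder (probFilter P) ρ Γ
        (fun q => sampleCov q.1 fun i => x i q.2)
        (fun q j => sampleT G q.1 (fun i => x i q.2) (Γ q j))
        (covTerm z) (scoreTerm P G z) (fun k => lam P G fun ω => z 0 ω k)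
        (fun k => del P G fun ω => z 0 ω k) ∧
      ∀ h : ℕ × Ω → ℝ, h =o[probFilter P] ρ →
        Tendsto (fun q => √(q.1 : ℝ) * h q) (probFilter P) (𝓝 0) := by
  obtain ⟨ρ, hρ, hC, hQ, hρ0, hρh⟩ := exists_rate_sample hG hz hs hmom
  have hZ := hz.measurable 0
  have htO := isBigO_dotProduct_latentMean hρ hΓ
  have ht : ∀ j, Tendsto (fun q => -(Γ q j ⬝ᵥ latentMean z q)) (probFilter P) (𝓝 0) := fun j =>
    (htO j).trans_tendsto hρ0
  have hmean : ∀ k, Tendsto (fun q => latentMean z q k) (probFilter P) (𝓝 0) := fun k =>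
    (hρ k).trans_tendsto hρ0
  have hB : ∀ j, Tendsto (fun q => empMean z
      (fun v => deriv G (Γ q j ⬝ᵥ v + -(Γ q j ⬝ᵥ latentMean z q)) * 1) q) (probFilter P)
      (𝓝 (∫ ω, deriv G (z 0 ω j) ∂P)) := fun j => by
    have := tendsto_empMean_nonlin hG hz hdom (hΓ j) (ht j) (φ := fun _ => 1) measurable_const
      (fun v => by simpa using one_le_weight v)
      (by simpa using (hmom.nonlin j).integrable one_le_two)
    simpa using this
  refine ⟨ρ, ⟨hΓ, hρ0, fun j m => ?_, hC, fun j m => ?_, hQ, fun j l hjl => ?_, fun j m => ?_, hw⟩,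
    hρh⟩
  · unfold covTerm
    congr 1
    ext v
    rw [mul_comm, Matrix.one_apply, Matrix.one_apply]
    simp only [eq_comm]
  · refine (isLittleO_mul_of_tendsto_zero (hmean j) (hρ m)).neg_left.congr' ?_ EventuallyEq.rfl
    filter_upwards [eventually_pos_probFilter] with q hq
    rw [dev, sampleCov_apply hx hq, covTerm, empMean_sub, empMean_const hq]
    ring
  · have hφw : ∀ v : Fin p → ℝ, |v l| ≤ weight v := fun v => abs_le_weight v l
    have hscale : (fun q => ∑ m, |dev Γ j m q| + |-(Γ q j ⬝ᵥ latentMean z q)|)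
        =O[probFilter P] rowScale ρ Γ j :=
      (IsBigO.fun_sum fun m _ => (dev_isBigO_rowScale j m).abs_left).add
        ((htO j).abs_left.trans (isBigO_rowScale j))
    have h1 := (isLittleO_empMean_taylor hG hz hdom (hΓ j) (ht j) (φ := fun v => v l)
      hφw).trans_isBigO hscale
    have h2 : (fun q => ∑ m, (empMean z (fun v => deriv (deriv G) (v j) * (v m * v l)) q
          - del P G (fun ω => z 0 ω j) * (1 : Matrix (Fin p) (Fin p) ℝ) m l) * dev Γ j m q)
        =o[probFilter P] rowScale ρ Γ j := by
      refine IsLittleO.fun_sum fun m _ => isLittleO_mul_of_tendsto_zero ?_ (dev_isBigO_rowScale j m)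
      rw [← hs.integral_deriv_nonlin_mul_mul hG hZ hjl m]
      simpa using (hz.tendsto_empMean_deriv_mul hG hdom j (φ := fun v => v m * v l) (by fun_prop)
        (abs_mul_le_weight_sq m hφw)).sub_const
          (∫ ω, deriv (deriv G) (z 0 ω j) * (z 0 ω m * z 0 ω l) ∂P)
    have h3 : (fun q => empMean z (fun v => deriv (deriv G) (v j) * v l) q
        * -(Γ q j ⬝ᵥ latentMean z q)) =o[probFilter P] rowScale ρ Γ j := by
      refine (isLittleO_mul_of_tendsto_zero ?_ (htO j)).trans_isBigO (isBigO_rowScale j)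
      rw [← hs.integral_deriv_nonlin_mul hG hZ hjl]
      exact hz.tendsto_empMean_deriv_mul hG hdom j (φ := fun v => v l) (by fun_prop)
        fun v => (hφw v).trans (weight_le_sq v)
    have h4 : (fun q => (empMean z
        (fun v => deriv G (Γ q j ⬝ᵥ v + -(Γ q j ⬝ᵥ latentMean z q)) * 1) q
          - ∫ ω, deriv G (z 0 ω j) ∂P) * latentMean z q l) =o[probFilter P] rowScale ρ Γ j := by
      refine (isLittleO_mul_of_tendsto_zero ?_ (hρ l)).trans_isBigO (isBigO_rowScale j)
      simpa using (hB j).sub_const (∫ ω, deriv G (z 0 ω j) ∂P)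
    refine (((h1.add h2).add h3).sub h4).congr' ?_ EventuallyEq.rfl
    filter_upwards [eventually_pos_probFilter] with q hq
    have h5 : ∑ m, (empMean z (fun v => deriv (deriv G) (v j) * (v m * v l)) q
          - del P G (fun ω => z 0 ω j) * (1 : Matrix (Fin p) (Fin p) ℝ) m l) * dev Γ j m q
        = ∑ m, dev Γ j m q * empMean z (fun v => deriv (deriv G) (v j) * (v m * v l)) q
          - del P G (fun ω => z 0 ω j) * dev Γ j l q := by
      simp only [sub_mul, Finset.sum_sub_distrib]
      congr 1
      · exact Finset.sum_congr rfl fun m _ => mul_comm _ _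
      · simp [Matrix.one_apply]
    have h6 : scoreTerm P G z j l q = empMean z (fun v => deriv G (v j) * v l) q
        - (∫ ω, deriv G (z 0 ω j) ∂P) * latentMean z q l := by
      simp only [scoreTerm, sub_mul]
      rw [empMean_sub, empMean_const_mul, latentMean]
    rw [h5, sampleT_apply hx hq, h6]
    simp only [dev]
    ring
  · have h1 := tendsto_empMean_nonlin hG hz hdom (hΓ j) (ht j) (φ := fun v => v m)
      (measurable_pi_apply m) (fun v => abs_le_weight v m) (hmom.integrable_nonlin_mul hs hZ j m)
    have h2 := h1.sub ((hmean m).mul (hB j))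
    rw [hs.integral_nonlin_mul hG hZ, zero_mul, sub_zero] at h2
    refine h2.congr' ?_
    filter_upwards [eventually_pos_probFilter] with q hq
    rw [sampleT_apply hx hq]

end SampleExpansion

/-! ### Asymptotic variances -/

section AsymptoticVariance

variable {Ω : Type*} [MeasurableSpace Ω] {P : Measure Ω} {p : ℕ}
  {z x : ℕ → Ω → Fin p → ℝ} {loc : Fin p → ℝ} {G : ℝ → ℝ}
  {Γhat : ℕ → Ω → Matrix (Fin p) (Fin p) ℝ} {j l : Fin p}

/-- Subtracting λ_j C_jl from Q_jl replaces the centred g(z_j) by its residual. -/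
theorem empMean_influence (hjl : j ≠ l) (a b c : ℝ) (q : ℕ × Ω) :
    empMean z (influence P G (z 0) j l a b c) q
      = a * (scoreTerm P G z j l q - lam P G (fun ω => z 0 ω j) * covTerm z j l q)
        + b * (scoreTerm P G z l j q - lam P G (fun ω => z 0 ω l) * covTerm z j l q)
        + c * covTerm z j l q := by
  simp only [scoreTerm, covTerm, ← empMean_const_mul, ← empMean_sub, ← empMean_add]
  congr 1
  ext v
  simp only [influence, residual, Matrix.one_apply_ne hjl]
  ring

theorem IsConsistentSolution.eventually
    {Eqs : ℕ → (ℕ → Fin p → ℝ) → Matrix (Fin p) (Fin p) ℝ → Prop}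
    (h : IsConsistentSolution P Eqs x Γhat) :
    ∀ᶠ q in probFilter P, Eqs q.1 (fun i => x i q.2) (Γhat q.1 q.2) :=
  eventually_probFilter.2 h.solves

theorem IsConsistentSolution.dev_tendsto
    {Eqs : ℕ → (ℕ → Fin p → ℝ) → Matrix (Fin p) (Fin p) ℝ → Prop}
    (h : IsConsistentSolution P Eqs x Γhat) (j m : Fin p) :
    Tendsto (dev (fun q : ℕ × Ω => Γhat q.1 q.2) j m) (probFilter P) (𝓝 0) := by
  have h1 := tendstoInMeasure_iff_probFilter.1 (h.consistent j m)
  unfold dev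
  exact h1

theorem tendsto_real_sign {A : Type*} {L : Filter A} {f : A → ℝ} {c : ℝ} (hf : Tendsto f L (𝓝 c))
    (hc : c ≠ 0) : Tendsto (fun q => Real.sign (f q)) L (𝓝 (Real.sign c)) := by
  refine tendsto_const_nhds.congr' ?_
  rcases hc.lt_or_gt with h | h
  · filter_upwards [hf.eventually_lt_const h] with q hq
    rw [Real.sign_of_neg h, Real.sign_of_neg hq]
  · filter_upwards [hf.eventually_const_lt h] with q hq
    rw [Real.sign_of_pos h, Real.sign_of_pos hq]

theorem abs_real_sign_le_one (y : ℝ) : |Real.sign y| ≤ 1 := by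
  rcases Real.sign_apply_eq y with h | h | h <;> rw [h] <;> norm_num

theorem sign_mul_eq_zero_iff (y w : ℝ) : Real.sign y * w = 0 ↔ y * w = 0 := by
  simp [Real.sign_eq_zero_iff]

theorem sign_mul_nonneg {y w : ℝ} (h : 0 ≤ y * w) : 0 ≤ Real.sign y * w := by
  rcases lt_trichotomy y 0 with hy | rfl | hy
  · rw [Real.sign_of_neg hy]
    nlinarith [nonpos_of_mul_nonneg_right h hy]
  · simp
  · rw [Real.sign_of_pos hy]
    nlinarith [nonneg_of_mul_nonneg_right h hy]

variable [IsProbabilityMeasure P]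

theorem hasASVSum_of_influence (hG : IsContrast G) (hz : IsIIDSample P z) (hs : IsSource P (z 0))
    (hmom : HasMoments P G (z 0)) (hm : ∀ n a b, Measurable fun ω => Γhat n ω a b) (hjl : j ≠ l)
    {ρ : ℕ × Ω → ℝ} (hρ : ∀ h : ℕ × Ω → ℝ, h =o[probFilter P] ρ →
      Tendsto (fun q => √(q.1 : ℝ) * h q) (probFilter P) (𝓝 0)) {a b c a' b' c' : ℝ}
    (h1 : (fun q => dev (fun q : ℕ × Ω => Γhat q.1 q.2) j l q
      - empMean z (influence P G (z 0) j l a b c) q) =o[probFilter P] ρ)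
    (h2 : (fun q => dev (fun q : ℕ × Ω => Γhat q.1 q.2) l j q
      - empMean z (influence P G (z 0) j l a' b' c') q) =o[probFilter P] ρ) :
    HasASVSum P Γhat j l
      ((a ^ 2 + a' ^ 2) * (sigmaSq P G (fun ω => z 0 ω j) - lam P G (fun ω => z 0 ω j) ^ 2)
        + (b ^ 2 + b' ^ 2) * (sigmaSq P G (fun ω => z 0 ω l) - lam P G (fun ω => z 0 ω l) ^ 2)
        + (c ^ 2 + c' ^ 2)) := by
  have hZ := hz.measurable 0
  refine ⟨_, _, hz.hasASV (hG.measurable_influence a b c) (hmom.memLp_influence hG hs hZ hjl a b c)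
    (hmom.integral_influence hG hs hZ hjl a b c) (fun n => hm n j l) (hρ _ h1),
    hz.hasASV (hG.measurable_influence a' b' c') (hmom.memLp_influence hG hs hZ hjl a' b' c')
    (hmom.integral_influence hG hs hZ hjl a' b' c') (fun n => hm n l j) (hρ _ h2), ?_⟩
  rw [Real.coe_toNNReal _ (integral_nonneg fun ω => sq_nonneg _),
    Real.coe_toNNReal _ (integral_nonneg fun ω => sq_nonneg _),
    hmom.integral_influence_sq hG hs hZ hjl, hmom.integral_influence_sq hG hs hZ hjl]
  ring

theorem hasASVSum_deflation (hG : IsContrast G) (hx : ∀ i ω, x i ω = loc + z i ω)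
    (hz : IsIIDSample P z) (hs : IsSource P (z 0)) (hmom : HasMoments P G (z 0))
    (hdom : LocallyDominated P G (z 0)) (h : IsConsistentSolution P (IsDeflation G) x Γhat)
    (hjl : j < l)
    (hne : ∀ k ≤ j, lam P G (fun ω => z 0 ω k) ≠ del P G (fun ω => z 0 ω k)) :
    HasASVSum P Γhat j l
      (weighted 1 0 (alpha P G fun ω => z 0 ω j) (alpha P G fun ω => z 0 ω l)) := by
  obtain ⟨ρ, hF, hρ⟩ := exists_isFirstOrder hG hx hz hs hmom hdom h.dev_tendsto
    (h.eventually.mono fun q hq => hq.1)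
  obtain ⟨h1, h2⟩ := hF.deflation (h.eventually.mono fun q hq => hq.2) hjl hne
  set d := lam P G (fun ω => z 0 ω j) - del P G (fun ω => z 0 ω j) with hd
  have hd0 : d ≠ 0 := sub_ne_zero.2 (hne j le_rfl)
  -- The two entries have opposite residual parts, giving 2α_j; the term -C_jl of the constraint
  -- falls on the entry (l, j) alone and gives the summand 1.
  have := hasASVSum_of_influence hG hz hs hmom h.measurable hjl.ne hρ
    (a := d⁻¹) (b := 0) (c := 0) (a' := -d⁻¹) (b' := 0) (c' := -1)
    (h1.congr_left fun q => by rw [empMean_influence hjl.ne]; ring)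
    (h2.congr_left fun q => by rw [empMean_influence hjl.ne]; ring)
  convert! this using 1
  simp only [weighted, alpha, ← hd]
  field_simp
  ring

/-- The estimates that solve `w j γ_lᵀ T(γ_j) = w l γ_jᵀ T(γ_l)` for all `j`, `l`, with random
weights `w`. -/
theorem hasASVSum_weighted {Eqs : ℕ → (ℕ → Fin p → ℝ) → Matrix (Fin p) (Fin p) ℝ → Prop}
    (hG : IsContrast G) (hx : ∀ i ω, x i ω = loc + z i ω)
    (hz : IsIIDSample P z) (hs : IsSource P (z 0)) (hmom : HasMoments P G (z 0))
    (hdom : LocallyDominated P G (z 0)) (h : IsConsistentSolution P Eqs x Γhat)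
    {w : Fin p → ℕ × Ω → ℝ} {β : Fin p → ℝ}
    (hEqs : ∀ᶠ q in probFilter P, IsWhitening q.1 (fun i => x i q.2) (Γhat q.1 q.2) ∧
      ∀ j l, w j q * (Γhat q.1 q.2 l ⬝ᵥ sampleT G q.1 (fun i => x i q.2) (Γhat q.1 q.2 j))
        = w l q * (Γhat q.1 q.2 j ⬝ᵥ sampleT G q.1 (fun i => x i q.2) (Γhat q.1 q.2 l)))
    (hw : ∀ k, w k =O[probFilter P] fun _ => (1 : ℝ))
    (hβ : ∀ k, Tendsto (fun q => w k q
      * (lam P G (fun ω => z 0 ω k) - del P G (fun ω => z 0 ω k))) (probFilter P) (𝓝 (β k)))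
    (hne : ∀ j l, j ≠ l → β j + β l ≠ 0) (hjl : j ≠ l) {b c : ℝ}
    (hb : Tendsto (w j) (probFilter P) (𝓝 b)) (hc : Tendsto (w l) (probFilter P) (𝓝 c))
    (hbβ : β j = b * (lam P G (fun ω => z 0 ω j) - del P G (fun ω => z 0 ω j)))
    (hcβ : β l = c * (lam P G (fun ω => z 0 ω l) - del P G (fun ω => z 0 ω l)))
    (hj0 : lam P G (fun ω => z 0 ω j) - del P G (fun ω => z 0 ω j) ≠ 0)
    (hl0 : lam P G (fun ω => z 0 ω l) - del P G (fun ω => z 0 ω l) ≠ 0) :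
    HasASVSum P Γhat j l
      (weighted (β j) (β l) (alpha P G fun ω => z 0 ω j) (alpha P G fun ω => z 0 ω l)) := by
  obtain ⟨ρ, hF, hρ⟩ := exists_isFirstOrder hG hx hz hs hmom hdom h.dev_tendsto
    (hEqs.mono fun q hq => hq.1)
  have heq := hEqs.mono fun q hq => hq.2
  have h1 := hF.symmetric hw hβ hne heq hjl hb hc
  have h2 := hF.symmetric hw hβ hne heq hjl.symm hc hb
  rw [add_comm (β l)] at h2
  have hs0 := hne j l hjl
  -- Since Q_lj - δ_l C_jl = (Q_lj - λ_l C_jl) + (λ_l - δ_l) C_jl and c (λ_l - δ_l) = β_l, the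
  -- coefficient of C_jl is -β_l / (β_j + β_l); for the entry (l, j) it is -β_j / (β_j + β_l).
  have := hasASVSum_of_influence hG hz hs hmom h.measurable hjl hρ
    (a := (β j + β l)⁻¹ * b) (b := -((β j + β l)⁻¹ * c)) (c := -((β j + β l)⁻¹ * β l))
    (a' := -((β j + β l)⁻¹ * b)) (b' := (β j + β l)⁻¹ * c) (c' := -((β j + β l)⁻¹ * β j))
    (h1.congr_left fun q => by
      rw [empMean_influence hjl]
      linear_combination (-(β j + β l)⁻¹ * covTerm z j l q) * hcβ)
    (h2.congr_left fun q => by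
      rw [empMean_influence hjl, hF.cov_symm l j]
      linear_combination (-(β j + β l)⁻¹ * covTerm z j l q) * hbβ)
  convert! this using 1
  have ej : β j ^ 2 * alpha P G (fun ω => z 0 ω j)
      = b ^ 2 * (sigmaSq P G (fun ω => z 0 ω j) - lam P G (fun ω => z 0 ω j) ^ 2) := by
    rw [hbβ, alpha]
    field_simp
  have el : β l ^ 2 * alpha P G (fun ω => z 0 ω l)
      = c ^ 2 * (sigmaSq P G (fun ω => z 0 ω l) - lam P G (fun ω => z 0 ω l) ^ 2) := by
    rw [hcβ, alpha]
    field_simp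
  simp only [weighted, div_eq_mul_inv]
  linear_combination 2 * ((β j + β l)⁻¹) ^ 2 * (ej + el)

end AsymptoticVariance

end FastICA

theorem theorem2 {p : ℕ} {Ω : Type*} [MeasurableSpace Ω] (P : Measure Ω) [IsProbabilityMeasure P]
    (G : ℝ → ℝ) (hG : IsContrast G)
    (z x : ℕ → Ω → Fin p → ℝ) (loc : Fin p → ℝ) (hx : ∀ i ω, x i ω = loc + z i ω)
    (hiid : IsIIDSample P z) (hsource : IsSource P (z 0)) (hmom : HasMoments P G (z 0))
    (hdom : LocallyDominated P G (z 0))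
    (ν lm δ s α : Fin p → ℝ)
    (hν : ∀ k, ν k = nu P G (fun ω => z 0 ω k))
    (hlm : ∀ k, lm k = lam P G (fun ω => z 0 ω k))
    (hδ : ∀ k, δ k = del P G (fun ω => z 0 ω k))
    (hs : ∀ k, s k = sgn P G (fun ω => z 0 ω k))
    (hα : ∀ k, α k = alpha P G (fun ω => z 0 ω k))
    (hnonneg : ∀ k, 0 ≤ ν k * (lm k - δ k))
    (hzero : ∀ k k', ν k * (lm k - δ k) = 0 → ν k' * (lm k' - δ k') = 0 → k = k')
    (j l : Fin p) (hjl : j ≠ l)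
    (hj : ¬ IsGaussianVar P (fun ω => z 0 ω j)) (hl : ¬ IsGaussianVar P (fun ω => z 0 ω l))
    (hj0 : ν j * (lm j - δ j) ≠ 0) (hl0 : ν l * (lm l - δ l) ≠ 0) :
    -- deflation-based: component `j` is extracted before component `l`
    (j < l → (∀ k < j, lm k ≠ δ k) →
      ∀ Γhat, IsConsistentSolution P (IsDeflation G) x Γhat →
        HasASVSum P Γhat j l (weighted 1 0 (α j) (α l))) ∧
    -- symmetric
    ((∀ k, ν k = 0 → lm k = δ k) →
      ∀ Γhat, IsConsistentSolution P (IsSymmetric G) x Γhat →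
        HasASVSum P Γhat j l
          (weighted (s j * (lm j - δ j)) (s l * (lm l - δ l)) (α j) (α l))) ∧
    -- squared symmetric
    (∀ Γhat, IsConsistentSolution P (IsSquaredSymmetric G) x Γhat →
        HasASVSum P Γhat j l
          (weighted (ν j * (lm j - δ j)) (ν l * (lm l - δ l)) (α j) (α l))) := by
  have hd : ∀ k, lm k - δ k
      = lam P G (fun ω => z 0 ω k) - del P G (fun ω => z 0 ω k) := fun k => by rw [hlm, hδ]
  have hjd : lm j - δ j ≠ 0 := right_ne_zero_of_mul hj0
  have hld : lm l - δ l ≠ 0 := right_ne_zero_of_mul hl0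
  have hνj : ν j ≠ 0 := left_ne_zero_of_mul hj0
  have hνl : ν l ≠ 0 := left_ne_zero_of_mul hl0
  have hs' : ∀ k, s k = Real.sign (ν k) := fun k => by rw [hs, hν, sgn]
  rw [hα j, hα l]
  refine ⟨fun hlt hk Γhat hΓ => ?_, fun h0 Γhat hΓ => ?_, fun Γhat hΓ => ?_⟩
  · refine hasASVSum_deflation hG hx hiid hsource hmom hdom hΓ hlt fun k hkj => ?_
    rw [← hlm, ← hδ]
    rcases hkj.lt_or_eq with h | rfl
    · exact hk k h
    · exact sub_ne_zero.1 hjd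
  · have hlim := fun k => tendsto_sampleG hG hx hiid hsource hmom hdom hΓ.dev_tendsto k
    simp only [← hν] at hlim
    have hsgn : ∀ k, ν k ≠ 0 → Tendsto (fun q : ℕ × Ω =>
        Real.sign (sampleG G q.1 (fun i => x i q.2) (Γhat q.1 q.2 k))) (probFilter P)
        (𝓝 (s k)) := fun k hk => by
      rw [hs']
      exact tendsto_real_sign (hlim k) hk
    refine hasASVSum_weighted hG hx hiid hsource hmom hdom hΓ
      (w := fun k q => Real.sign (sampleG G q.1 (fun i => x i q.2) (Γhat q.1 q.2 k)))
      (β := fun k => s k * (lm k - δ k)) ?_ (fun k => ?_) (fun k => ?_) (fun k m hkm => ?_) hjl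
      (hsgn j hνj) (hsgn l hνl) (by rw [hd]) (by rw [hd]) (hd j ▸ hjd) (hd l ▸ hld)
    · filter_upwards [hΓ.eventually] with q hq
      exact ⟨hq.1, fun j l => by simpa only [mul_comm] using hq.2 j l⟩
    · exact IsBigO.of_bound 1 (Eventually.of_forall fun q => by
        simpa using abs_real_sign_le_one _)
    · rw [← hd]
      -- If ν_k = 0 the sign of the sample contrast need not converge, but then λ_k = δ_k makes the
      -- product zero.
      by_cases hk : ν k = 0
      · simpa [h0 k hk] using tendsto_const_nhds
      · exact (hsgn k hk).mul_const _
    · have h1 : ∀ k, 0 ≤ s k * (lm k - δ k) := fun k => by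
        rw [hs']
        exact sign_mul_nonneg (hnonneg k)
      intro hsum
      rw [add_eq_zero_iff_of_nonneg (h1 k) (h1 m), hs', hs', sign_mul_eq_zero_iff,
        sign_mul_eq_zero_iff] at hsum
      exact hkm (hzero k m hsum.1 hsum.2)
  · have hlim := fun k => tendsto_sampleG hG hx hiid hsource hmom hdom hΓ.dev_tendsto k
    simp only [← hν] at hlim
    refine hasASVSum_weighted hG hx hiid hsource hmom hdom hΓ
      (w := fun k q => sampleG G q.1 (fun i => x i q.2) (Γhat q.1 q.2 k))
      (β := fun k => ν k * (lm k - δ k)) ?_ (fun k => (hlim k).isBigO_one ℝ)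
      (fun k => by rw [← hd]; exact (hlim k).mul_const _) (fun k m hkm hsum => ?_) hjl
      (hlim j) (hlim l) (by rw [hd]) (by rw [hd]) (hd j ▸ hjd) (hd l ▸ hld)
    · filter_upwards [hΓ.eventually] with q hq
      refine ⟨hq.1, fun j l => ?_⟩
      simpa only [sampleT2, dotProduct_smul, smul_eq_mul] using hq.2 j l
    · rw [add_eq_zero_iff_of_nonneg (hnonneg k) (hnonneg m)] at hsum
      exact hkm (hzero k m hsum.1 hsum.2)
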